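/- Let $d\ge 1$, $\lambda>1$, and let $M=G+\lambda uu^{*}$, where $G\in\mathbb{R}^{d\times d}$ has i.i.d. $\mathcal N(0,1/d)$ entries (the real Ginibre law) and $u$ is independent of $G$ and uniformly distributed on the unit sphere of $\mathbb{R}^d$. Consider any adaptive, possibly randomized, one-side query algorithm: in round $t=1,2,\dots,N$ it chooses a query $v^{(t)}\in\mathbb{C}^d$ as a measurable function of the earlier pairs $(v^{(i)},w^{(i)})_{i<t}$ and of an internal random seed independent of $(G,u)$, and then receives $w^{(t)}=Mv^{(t)}$. Let $\delta\in(0,1/e)$ and set $$\tau_0(\delta)=\frac{64}{\lambda^{2}(\lambda-1)^{2}}\Bigl(\log\frac1\delta+\frac1{\log\lambda}\Bigr),\qquad \tau_k(\delta)=\lambda^{4k}\,\tau_0(\delta)\quad(k\ge 0).$$ Assume that the algorithm makes orthonormal queries, in either of the following two senses (for every input matrix in $\mathbb R^{d\times d}$ and every seed): (a) the $2N$ real vectors $\operatorname{Re}v^{(1)},\operatorname{Im}v^{(1)},\dots,\operatorname{Re}v^{(N)},\operatorname{Im}v^{(N)}$ are orthonormal in $\mathbb{R}^d$; in this case put $V_k=[\operatorname{Re}v^{(1)}\mid\operatorname{Im}v^{(1)}\mid\cdots\mid\operatorname{Re}v^{(k)}\mid\operatorname{Im}v^{(k)}]\in\mathbb{R}^{d\times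 2k}$; or (b) $v^{(1)},\dots,v^{(N)}$ are orthonormal in $\mathbb{C}^d$ (in particular, they may be orthonormal real vectors); in this case put $V_k=[v^{(1)}\mid\cdots\mid v^{(k)}]\in\mathbb{C}^{d\times k}$. Then, in each of the two cases, $$\mathbb{P}\Bigl[\exists\,k\in\{0,1,\dots,N\}:\ u^{*}V_kV_k^{*}u>\frac{\tau_k(\delta)}{d}\Bigr]\le\delta,$$ where the probability is over $G$, $u$ and the seed of the algorithm. -/

import Mathlib

open MeasureTheory ProbabilityTheory Matrix

noncomputable section

/-- The real Ginibre law `GinOE(d)`: the law of the array of entries of a real `d × d` matrix with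
i.i.d. `N(0, 1/d)` entries. -/
def ginOE (d : ℕ) : Measure (Fin d → Fin d → ℝ) :=
  Measure.pi fun _ : Fin d => Measure.pi fun _ : Fin d => gaussianReal 0 ((d : NNReal)⁻¹)

/-- The uniform probability measure on the unit sphere of `ℝ^d`: normalised surface measure. -/
def sphereUniform (d : ℕ) : Measure (Metric.sphere (0 : EuclideanSpace ℝ (Fin d)) 1) :=
  ((volume : Measure (EuclideanSpace ℝ (Fin d))).toSphere Set.univ)⁻¹ •
    (volume : Measure (EuclideanSpace ℝ (Fin d))).toSphere

/-- The spiked matrix `G + lam · u uᵀ`. -/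
def spikedMatrix {d : ℕ} (lam : ℝ) (G : Matrix (Fin d) (Fin d) ℝ)
    (u : EuclideanSpace ℝ (Fin d)) : Matrix (Fin d) (Fin d) ℝ :=
  G + lam • Matrix.vecMulVec u.ofLp u.ofLp

/-- The answer `M v` of the one-side oracle for a real matrix `M` to a complex query `v`. -/
def oracle {d : ℕ} (M : Matrix (Fin d) (Fin d) ℝ) (v : EuclideanSpace ℂ (Fin d)) :
    EuclideanSpace ℂ (Fin d) :=
  WithLp.toLp 2 ((M.map Complex.ofReal) *ᵥ v.ofLp)

/-- An adaptive randomised one-side query algorithm with internal random seed in `S`: the next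
query is a measurable function of the seed and of the history of the query-answer pairs
`((v⁽¹⁾, w⁽¹⁾), …, (v⁽ᵗ⁾, w⁽ᵗ⁾))` so far. A deterministic algorithm is the case of a one-point
seed space. -/
structure QueryAlgorithm (d : ℕ) (S : Type*) [MeasurableSpace S] where
  query : (t : ℕ) →
    S × (Fin t → EuclideanSpace ℂ (Fin d) × EuclideanSpace ℂ (Fin d)) → EuclideanSpace ℂ (Fin d)
  measurable_query : ∀ t, Measurable (query t)

namespace QueryAlgorithm

variable {d : ℕ} {S : Type*} [MeasurableSpace S]

/-- The history after `t` rounds of the algorithm, run on the matrix `M` with seed `s`. -/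
def history (A : QueryAlgorithm d S) (M : Matrix (Fin d) (Fin d) ℝ) (s : S) :
    (t : ℕ) → Fin t → EuclideanSpace ℂ (Fin d) × EuclideanSpace ℂ (Fin d)
  | 0 => Fin.elim0
  | t + 1 =>
    Fin.snoc (α := fun _ => EuclideanSpace ℂ (Fin d) × EuclideanSpace ℂ (Fin d))
      (A.history M s t)
      (A.query t (s, A.history M s t), oracle M (A.query t (s, A.history M s t)))

/-- The query made after `t` completed rounds, that is, `v⁽ᵗ⁺¹⁾`. -/
def queryAt (A : QueryAlgorithm d S) (M : Matrix (Fin d) (Fin d) ℝ) (s : S) (t : ℕ) :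
    EuclideanSpace ℂ (Fin d) :=
  A.query t (s, A.history M s t)

/-- The complex `d × k` matrix `[v⁽¹⁾ | … | v⁽ᵏ⁾]` of the first `k` queries. -/
def complexV (A : QueryAlgorithm d S) (M : Matrix (Fin d) (Fin d) ℝ) (s : S) (k : ℕ) :
    Matrix (Fin d) (Fin k) ℂ :=
  Matrix.of fun i j => A.queryAt M s j i

/-- The real `d × 2k` matrix `[Re v⁽¹⁾ | Im v⁽¹⁾ | … | Re v⁽ᵏ⁾ | Im v⁽ᵏ⁾]` of the real and imaginary
parts of the first `k` queries; the column `(j, 0)` is a real part, `(j, 1)` an imaginary part. -/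
def realV (A : QueryAlgorithm d S) (M : Matrix (Fin d) (Fin d) ℝ) (s : S) (k : ℕ) :
    Matrix (Fin d) (Fin k × Fin 2) ℝ :=
  Matrix.of fun i j =>
    if j.2 = 0 then (A.queryAt M s j.1 i).re else (A.queryAt M s j.1 i).im

end QueryAlgorithm

/-- The Stiefel manifold: `d`-row matrices with orthonormal columns. -/
def Stief (𝕜 : Type*) [RCLike 𝕜] (d : ℕ) (ι : Type*) [DecidableEq ι] :
    Set (Matrix (Fin d) ι 𝕜) :=
  {V | Vᴴ * V = 1}

/-- The potential `Φ(V; u) = u* V V* u`, a real number, for a real vector `u`. -/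
def overlap {𝕜 : Type*} [RCLike 𝕜] {d : ℕ} {ι : Type*} [Fintype ι]
    (V : Matrix (Fin d) ι 𝕜) (u : EuclideanSpace ℝ (Fin d)) : ℝ :=
  RCLike.re ((fun i => star (u i : 𝕜)) ⬝ᵥ ((V * Vᴴ) *ᵥ fun i => (u i : 𝕜)))

/-- The threshold
`τ_k(δ) = lam^{4k} · 64 lam⁻² (lam - 1)⁻² (log δ⁻¹ + 1 / log lam)`. -/
def threshold (lam δ : ℝ) (k : ℕ) : ℝ :=
  lam ^ (4 * k) *
    (64 * (lam ^ 2)⁻¹ * ((lam - 1) ^ 2)⁻¹ * (Real.log δ⁻¹ + (Real.log lam)⁻¹))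

end

/-!
The proof bounds a larger quantity, for which orthonormality of the queries plays no role. Let `P`
be the orthogonal projection onto the real span of the real and imaginary parts of the first `k`
queries. In both cases the overlap is at most `‖P u‖²` (`overlap_le_of_mul_eq`), and `P` has real
rank at most `2 k`. The claim is therefore that `‖P u‖²` stays below the thresholds for every
algorithm, and by a union bound over the first crossing it suffices to bound the probability that
`‖P u‖²` jumps from below `τ_k / d` to above `τ_{k+1} / d` in one round
(`lintegral_measure_threshold_jump_le`).

The jump probability is compared with the one for the pure noise matrix `G`, where the queries are
independent of `u`. The law of the first `k` rounds under `G + lam u uᵀ` has the density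
`exp (d lam ⟪u, G P u⟫ - d lam² ‖P u‖² / 2)` with respect to that under `G`
(`lintegral_ginOE_spiked`). To see this without conditional distributions on the space of histories,
one shows that `G P + G' (1 - P)`, with `G'` an independent copy, is again Ginibre although `P`
depends on `G` (`lintegral_ginOE_resample_spanProj`, by induction on the number of rounds); since
the history depends only on `G P`, averaging the Cameron–Martin density of the shift `lam u uᵀ` over
`G'` leaves the stated density. A power of this density is, up to a factor depending on `‖P u‖²`,
the density of a larger spike (`likelihood_rpow`), so on the event `‖P u‖² ≤ τ_k / d` its moment of
order `lam` is explicit. Hölder's inequality with the exponent `lam` then bounds the jump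
probability by this moment and the probability that `‖P u‖² > τ_{k+1} / d` when `P` is independent
of `u` (`lintegral_measure_jump_le`).

The last probability is a Chernoff bound (`sphereUniform_spanOverlap_le`): in polar coordinates the
uniform measure of a set of unit vectors is compared with the integral of `exp (-‖L x‖² / 2)` for
`L = a P + b (1 - P)`, which is governed by `det L`. The determinant is bounded along the
Gram–Schmidt recursion defining `P` (`IsOrthProj.det_projExtend`). The growth factor `lam ^ 4` of the
thresholds makes this probability win over the moment of the likelihood ratio, with a bound summable to `δ`.
-/

noncomputable section

open scoped ENNReal

/-! ### Measurability of matrix-valued maps -/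

instance Matrix.instMeasurableSpaceReal {m n : Type*} : MeasurableSpace (Matrix m n ℝ) :=
  inferInstanceAs (MeasurableSpace (m → n → ℝ))

instance Matrix.instBorelSpaceReal {m n : Type*} [Fintype m] [Fintype n] :
    BorelSpace (Matrix m n ℝ) :=
  inferInstanceAs (BorelSpace (m → n → ℝ))

instance Matrix.instSecondCountableTopologyReal {m n : Type*} [Fintype m] [Fintype n] :
    SecondCountableTopology (Matrix m n ℝ) :=
  inferInstanceAs (SecondCountableTopology (m → n → ℝ))

@[fun_prop]
theorem Matrix.measurable_of {m n : Type*} :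
    Measurable (Matrix.of : (m → n → ℝ) → Matrix m n ℝ) :=
  measurable_id

/-! ### The Ginibre law: density, shifts and swaps -/

/-- A power of a measure with a density is the measure whose density is the product. -/
theorem pi_withDensity_ofReal {ι E : Type*} [Fintype ι] [MeasureSpace E]
    [SigmaFinite (volume : Measure E)] {f : E → ℝ} (hf : Integrable f) (h0 : ∀ x, 0 ≤ f x) :
    Measure.pi (fun _ : ι => (volume : Measure E).withDensity fun x => ENNReal.ofReal (f x)) =
      (volume : Measure (ι → E)).withDensity fun x => ENNReal.ofReal (∏ i, f (x i)) := by
  classical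
  refine Measure.pi_eq fun s hs => ?_
  have hg : ∀ i, Integrable ((s i).indicator f) := fun i => hf.indicator (hs i)
  have hg0 : ∀ i x, 0 ≤ (s i).indicator f x := fun i x => Set.indicator_nonneg (fun x _ => h0 x) x
  have key : ∀ x : ι → E, (Set.pi Set.univ s).indicator
      (fun x => ENNReal.ofReal (∏ i, f (x i))) x =
        ENNReal.ofReal (∏ i, (s i).indicator f (x i)) := by
    intro x
    by_cases hx : x ∈ Set.pi Set.univ s
    · rw [Set.indicator_of_mem hx]
      congr 1
      exact Finset.prod_congr rfl fun i _ => (Set.indicator_of_mem (hx i trivial) _).symm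
    · rw [Set.indicator_of_notMem hx]
      simp only [Set.mem_pi, Set.mem_univ, true_imp_iff, not_forall] at hx
      obtain ⟨i, hi⟩ := hx
      rw [Finset.prod_eq_zero (Finset.mem_univ i) (Set.indicator_of_notMem hi f)]
      simp
  rw [withDensity_apply _ (MeasurableSet.univ_pi hs),
    ← lintegral_indicator (MeasurableSet.univ_pi hs)]
  simp_rw [key]
  have hint : Integrable (fun x : ι → E => ∏ i, (s i).indicator f (x i)) :=
    Integrable.fintype_prod (μ := fun _ => volume) hg
  rw [← ofReal_integral_eq_lintegral_ofReal hint
    (Filter.Eventually.of_forall fun x => Finset.prod_nonneg fun i _ => hg0 i (x i)),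
    integral_fintype_prod_volume_eq_prod (fun i => (s i).indicator f),
    ENNReal.ofReal_prod_of_nonneg fun i _ => integral_nonneg (hg0 i)]
  refine Finset.prod_congr rfl fun i _ => ?_
  rw [ofReal_integral_eq_lintegral_ofReal (hg i) (Filter.Eventually.of_forall (hg0 i)),
    withDensity_apply _ (hs i), ← lintegral_indicator (hs i)]
  refine lintegral_congr fun x => ?_
  by_cases hx : x ∈ s i <;> simp [hx]

instance ginOE.instIsProbabilityMeasure (d : ℕ) : IsProbabilityMeasure (ginOE d) := by
  unfold ginOE; infer_instance

/-- The Lebesgue density of the Ginibre law, up to its normalising constant. -/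
def ginOEDensity {d : ℕ} (G : Matrix (Fin d) (Fin d) ℝ) : ℝ :=
  Real.exp (-(d / 2 : ℝ) * trace (G * Gᵀ))

theorem continuous_ginOEDensity {d : ℕ} :
    Continuous (ginOEDensity : Matrix (Fin d) (Fin d) ℝ → ℝ) := by
  unfold ginOEDensity
  fun_prop

@[fun_prop]
theorem measurable_ginOEDensity {d : ℕ} :
    Measurable (ginOEDensity : Matrix (Fin d) (Fin d) ℝ → ℝ) :=
  continuous_ginOEDensity.measurable

theorem ginOE_eq_withDensity {d : ℕ} (hd : 1 ≤ d) : ∃ c : ℝ, 0 ≤ c ∧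
    ginOE d = volume.withDensity fun G => ENNReal.ofReal (c * ginOEDensity (of G)) := by
  set v : NNReal := (d : NNReal)⁻¹
  have hv : v ≠ 0 := by positivity
  refine ⟨(√(2 * Real.pi * v))⁻¹ ^ (d * d), by positivity, ?_⟩
  have h1 : ∀ x, 0 ≤ gaussianPDFReal 0 v x := gaussianPDFReal_nonneg 0 v
  have e1 : Measure.pi (fun _ : Fin d => gaussianReal 0 v) = volume.withDensity fun x =>
      ENNReal.ofReal (∏ i, gaussianPDFReal 0 v (x i)) := by
    rw [← pi_withDensity_ofReal (integrable_gaussianPDFReal 0 v) h1,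
      gaussianReal_of_var_ne_zero _ hv]
    rfl
  rw [ginOE, e1, pi_withDensity_ofReal
    (Integrable.fintype_prod (μ := fun _ => volume) fun _ => integrable_gaussianPDFReal 0 v)
    fun x => Finset.prod_nonneg fun i _ => h1 _]
  congr 1
  ext G
  congr 1
  simp only [gaussianPDFReal, Finset.prod_mul_distrib, Finset.prod_const, Finset.card_univ,
    Fintype.card_fin, ← pow_mul, ginOEDensity, ← Real.exp_sum, trace, diag_apply, mul_apply,
    transpose_apply, of_apply, Finset.mul_sum]
  congr 3
  ext i
  congr 1
  ext j
  have : (v : ℝ) = (d : ℝ)⁻¹ := by simp [v]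
  rw [this]
  field_simp
  ring

theorem exists_lintegral_ginOE {d : ℕ} (hd : 1 ≤ d) : ∃ c : ℝ, 0 ≤ c ∧
    ∀ H : Matrix (Fin d) (Fin d) ℝ → ℝ≥0∞, Measurable H →
    ∫⁻ G, H (of G) ∂ginOE d =
      ∫⁻ G : Fin d → Fin d → ℝ, ENNReal.ofReal (c * ginOEDensity (of G)) * H (of G) := by
  obtain ⟨c, hc, h⟩ := ginOE_eq_withDensity hd
  refine ⟨c, hc, fun H hH => ?_⟩
  rw [h, lintegral_withDensity_eq_lintegral_mul _ (by fun_prop) (by fun_prop)]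
  rfl

/-- The Cameron–Martin formula for the Ginibre law. -/
theorem lintegral_ginOE_add {d : ℕ} (hd : 1 ≤ d) (D : Matrix (Fin d) (Fin d) ℝ)
    {H : Matrix (Fin d) (Fin d) ℝ → ℝ≥0∞} (hH : Measurable H) :
    ∫⁻ G, H (of G + D) ∂ginOE d =
      ∫⁻ G, ENNReal.ofReal (Real.exp (d * trace (of G * Dᵀ) - d / 2 * trace (D * Dᵀ))) *
        H (of G) ∂ginOE d := by
  obtain ⟨c, hc, h⟩ := exists_lintegral_ginOE hd
  have m1 : Measurable fun G : Matrix (Fin d) (Fin d) ℝ => G + D :=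
    (by fun_prop : Continuous fun G : Matrix (Fin d) (Fin d) ℝ => G + D).measurable
  have m2 : Measurable fun G : Matrix (Fin d) (Fin d) ℝ => ENNReal.ofReal
      (Real.exp (d * trace (G * Dᵀ) - d / 2 * trace (D * Dᵀ))) :=
    ENNReal.measurable_ofReal.comp (by fun_prop : Continuous fun G : Matrix (Fin d) (Fin d) ℝ =>
      Real.exp (d * trace (G * Dᵀ) - d / 2 * trace (D * Dᵀ))).measurable
  rw [h (fun G => H (G + D)) (hH.comp m1), h (fun G => ENNReal.ofReal
    (Real.exp (d * trace (G * Dᵀ) - d / 2 * trace (D * Dᵀ))) * H G) (m2.mul hH)]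
  rw [← lintegral_sub_right_eq_self (μ := (volume : Measure (Fin d → Fin d → ℝ)))
    (fun G => ENNReal.ofReal (c * ginOEDensity (of G)) * H (of G + D)) (of.symm D)]
  refine lintegral_congr fun G => ?_
  have e : of (G - of.symm D) = of G - D := rfl
  rw [e, sub_add_cancel, ← mul_assoc, ← ENNReal.ofReal_mul (by unfold ginOEDensity; positivity),
    mul_assoc]
  congr 3
  have e2 : trace (D * (of G)ᵀ) = trace (of G * Dᵀ) := by
    rw [← trace_transpose, transpose_mul, transpose_transpose]
  rw [ginOEDensity, ginOEDensity, ← Real.exp_add, transpose_sub, sub_mul, mul_sub, mul_sub,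
    trace_sub, trace_sub, trace_sub, e2]
  congr 1
  ring

/-- For a projection matrix `E` the involution `(G, G') ↦ (G E + G' (1 - E), G (1 - E) + G' E)`,
as a linear map. -/
def swapLinear {d : ℕ} (E : Matrix (Fin d) (Fin d) ℝ) :
    (Fin d → Fin d → ℝ) × (Fin d → Fin d → ℝ) →ₗ[ℝ] (Fin d → Fin d → ℝ) × (Fin d → Fin d → ℝ) where
  toFun z := (of.symm (of z.1 * E + of z.2 * (1 - E)), of.symm (of z.1 * (1 - E) + of z.2 * E))
  map_add' x y := by
    have h (a b : Fin d → Fin d → ℝ) : of (a + b) = of a + of b := rfl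
    have h' (a b : Matrix (Fin d) (Fin d) ℝ) : of.symm (a + b) = of.symm a + of.symm b := rfl
    simp only [Prod.fst_add, Prod.snd_add, h, add_mul, h', Prod.mk_add_mk, Prod.mk.injEq]
    constructor <;> abel
  map_smul' r x := by
    have h (a : Fin d → Fin d → ℝ) : of (r • a) = r • of a := rfl
    have h' (a : Matrix (Fin d) (Fin d) ℝ) : of.symm (r • a) = r • of.symm a := rfl
    simp only [Prod.smul_fst, Prod.smul_snd, h, smul_mul, ← smul_add, h', RingHom.id_apply,
      Prod.smul_mk]

theorem swapLinear_comp_self {d : ℕ} {E : Matrix (Fin d) (Fin d) ℝ} (hE : E * E = E) :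
    swapLinear E ∘ₗ swapLinear E = LinearMap.id := by
  have h1 : E * (1 - E) = 0 := by rw [mul_sub, hE, mul_one, sub_self]
  have h2 : (1 - E) * E = 0 := by rw [sub_mul, hE, one_mul, sub_self]
  have h3 : (1 - E) * (1 - E) = 1 - E := by rw [mul_sub, h2, mul_one, sub_zero]
  refine LinearMap.ext fun z => ?_
  simp only [swapLinear, LinearMap.comp_apply, LinearMap.coe_mk, AddHom.coe_mk, LinearMap.id_apply,
    Equiv.apply_symm_apply, add_mul, Matrix.mul_assoc, hE, h1, h2, h3, mul_zero, add_zero, zero_add,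
    ← mul_add, add_sub_cancel, sub_add_cancel, mul_one, Equiv.symm_apply_apply, Prod.mk.eta]

/-- An involution has determinant `±1`, hence preserves Lebesgue measure. -/
theorem measurePreserving_swapLinear {d : ℕ} {E : Matrix (Fin d) (Fin d) ℝ} (hE : E * E = E) :
    MeasurePreserving (swapLinear E) volume volume := by
  have hc : Continuous (swapLinear E) := LinearMap.continuous_of_finiteDimensional _
  have hdet : LinearMap.det (swapLinear E) * LinearMap.det (swapLinear E) = 1 := by
    rw [← LinearMap.det_comp, swapLinear_comp_self hE, LinearMap.det_id]
  have hne : LinearMap.det (swapLinear E) ≠ 0 := left_ne_zero_of_mul_eq_one hdet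
  refine ⟨hc.measurable, ?_⟩
  have hv₁ : ∀ _ : Fin d, (volume : Measure (Fin d → ℝ)).IsAddHaarMeasure := fun _ =>
    Measure.pi.isAddHaarMeasure fun _ : Fin d => (volume : Measure ℝ)
  have hv₂ : (volume : Measure (Fin d → Fin d → ℝ)).IsAddHaarMeasure :=
    Measure.pi.isAddHaarMeasure fun _ : Fin d => (volume : Measure (Fin d → ℝ))
  have hv : (volume : Measure ((Fin d → Fin d → ℝ) × (Fin d → Fin d → ℝ))).IsAddHaarMeasure :=
    Measure.prod.instIsAddHaarMeasure _ _
  rw [Measure.map_linearMap_addHaar_eq_smul_addHaar _ hne]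
  have : |(LinearMap.det (swapLinear E))⁻¹| = 1 := by
    rcases mul_self_eq_one_iff.mp hdet with h | h <;> simp [h]
  simp [this]

theorem ginOEDensity_swapLinear {d : ℕ} {E : Matrix (Fin d) (Fin d) ℝ} (hE : E * E = E)
    (hEt : Eᵀ = E) (z : (Fin d → Fin d → ℝ) × (Fin d → Fin d → ℝ)) :
    ginOEDensity (of (swapLinear E z).1) * ginOEDensity (of (swapLinear E z).2) =
      ginOEDensity (of z.1) * ginOEDensity (of z.2) := by
  obtain ⟨G, G'⟩ := z
  have h1 : E * (1 - E) = 0 := by rw [mul_sub, hE, mul_one, sub_self]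
  have h2 : (1 - E) * E = 0 := by rw [sub_mul, hE, one_mul, sub_self]
  have h3 : (1 - E) * (1 - E) = 1 - E := by rw [mul_sub, h2, mul_one, sub_zero]
  simp only [ginOEDensity, ← Real.exp_add, ← mul_add, ← trace_add]
  congr 3
  simp only [swapLinear, LinearMap.coe_mk, AddHom.coe_mk, Equiv.apply_symm_apply, transpose_add,
    transpose_mul, transpose_sub, transpose_one, hEt]
  generalize of G = X
  generalize of G' = Y
  have a1 : ∀ (F F' : Matrix (Fin d) (Fin d) ℝ) (X Y : Matrix (Fin d) (Fin d) ℝ),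
      X * F * (F' * Y) = X * (F * F') * Y := fun F F' X Y => by simp only [Matrix.mul_assoc]
  simp only [add_mul, mul_add, a1, hE, h1, h2, h3, mul_zero, zero_mul, add_zero, zero_add]
  simp only [Matrix.mul_assoc, sub_mul, mul_sub, one_mul]
  abel

/-- If `E` is an orthogonal projection and `G, G'` are independent Ginibre matrices, then
`G E + G' (1 - E)` is again a Ginibre matrix. -/
theorem lintegral_ginOE_resample {d : ℕ} (hd : 1 ≤ d) {E : Matrix (Fin d) (Fin d) ℝ}
    (hE : E * E = E) (hEt : Eᵀ = E)
    {H : Matrix (Fin d) (Fin d) ℝ → ℝ≥0∞} (hH : Measurable H) :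
    ∫⁻ G, H (of G) ∂ginOE d =
      ∫⁻ G, ∫⁻ G', H (of G * E + of G' * (1 - E)) ∂ginOE d ∂ginOE d := by
  obtain ⟨c, hc, h⟩ := ginOE_eq_withDensity hd
  set γ := ginOE d with hγ
  have hprod : γ.prod γ = (volume : Measure ((Fin d → Fin d → ℝ) × (Fin d → Fin d → ℝ))).withDensity
      fun z => ENNReal.ofReal (c * ginOEDensity (of z.1)) *
        ENNReal.ofReal (c * ginOEDensity (of z.2)) := by
    rw [h, prod_withDensity (by fun_prop) (by fun_prop)]
    rfl
  have hm : Measurable (swapLinear E) := (measurePreserving_swapLinear hE).measurable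
  have hdens : Measurable fun z : (Fin d → Fin d → ℝ) × (Fin d → Fin d → ℝ) =>
      ENNReal.ofReal (c * ginOEDensity (of z.1)) * ENNReal.ofReal (c * ginOEDensity (of z.2)) := by
    fun_prop
  have hHm : Measurable fun z : (Fin d → Fin d → ℝ) × (Fin d → Fin d → ℝ) => H (of z.1) := by
    fun_prop
  have hHs : Measurable fun z => H (of (swapLinear E z).1) := hHm.comp hm
  calc ∫⁻ G, H (of G) ∂γ = ∫⁻ z, H (of z.1) ∂γ.prod γ := by
        rw [lintegral_prod _ hHm.aemeasurable]
        simp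
    _ = ∫⁻ z, H (of (swapLinear E z).1) ∂γ.prod γ := by
        rw [hprod, lintegral_withDensity_eq_lintegral_mul _ hdens hHm,
          lintegral_withDensity_eq_lintegral_mul _ hdens hHs,
          ← (measurePreserving_swapLinear hE).lintegral_comp (hdens.mul hHm)]
        refine lintegral_congr fun z => ?_
        have := ginOEDensity_swapLinear hE hEt z
        have hp : ∀ G : Matrix (Fin d) (Fin d) ℝ, 0 ≤ c * ginOEDensity G := fun G => by
          unfold ginOEDensity; positivity
        simp only [Pi.mul_apply, ← ENNReal.ofReal_mul (hp _)]
        rw [mul_mul_mul_comm, this, mul_mul_mul_comm]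
    _ = _ := by
        rw [lintegral_prod _ hHs.aemeasurable]
        rfl

/-! ### Orthogonal projection matrices and their one-vector extensions -/

/-- A real matrix is the matrix of an orthogonal projection. -/
structure IsOrthProj {d : ℕ} (P : Matrix (Fin d) (Fin d) ℝ) : Prop where
  mul_self : P * P = P
  transpose_eq : Pᵀ = P

/-- The projection onto the span of the range of the projection `P` and the vector `v`: the
Gram–Schmidt step. If `v` is already in the range of `P`, the scalar is `0⁻¹ = 0` and `P` is
returned. -/
def projExtend {d : ℕ} (P : Matrix (Fin d) (Fin d) ℝ) (v : Fin d → ℝ) :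
    Matrix (Fin d) (Fin d) ℝ :=
  P + ((v - P *ᵥ v) ⬝ᵥ (v - P *ᵥ v))⁻¹ • vecMulVec (v - P *ᵥ v) (v - P *ᵥ v)

namespace IsOrthProj

variable {d : ℕ} {P : Matrix (Fin d) (Fin d) ℝ}

theorem zero : IsOrthProj (0 : Matrix (Fin d) (Fin d) ℝ) := ⟨by simp, by simp⟩

theorem mulVec_mulVec (hP : IsOrthProj P) (v : Fin d → ℝ) : P *ᵥ (P *ᵥ v) = P *ᵥ v := by
  rw [Matrix.mulVec_mulVec, hP.mul_self]

theorem vecMul_eq (hP : IsOrthProj P) (v : Fin d → ℝ) : v ᵥ* P = P *ᵥ v := by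
  rw [← mulVec_transpose, hP.transpose_eq]

theorem dotProduct_mulVec_eq (hP : IsOrthProj P) (v : Fin d → ℝ) :
    v ⬝ᵥ (P *ᵥ v) = (P *ᵥ v) ⬝ᵥ (P *ᵥ v) := by
  rw [← hP.mulVec_mulVec v, dotProduct_mulVec, hP.vecMul_eq, hP.mulVec_mulVec]

theorem dotProduct_mulVec_nonneg (hP : IsOrthProj P) (v : Fin d → ℝ) : 0 ≤ v ⬝ᵥ (P *ᵥ v) := by
  rw [hP.dotProduct_mulVec_eq]
  exact Finset.sum_nonneg fun i _ => mul_self_nonneg _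

theorem one_sub (hP : IsOrthProj P) : IsOrthProj (1 - P) :=
  ⟨by rw [mul_sub, sub_mul, sub_mul, one_mul, one_mul, Matrix.mul_one, hP.mul_self, sub_self,
      sub_zero],
    by rw [transpose_sub, transpose_one, hP.transpose_eq]⟩

theorem dotProduct_mulVec_le (hP : IsOrthProj P) (v : Fin d → ℝ) :
    v ⬝ᵥ (P *ᵥ v) ≤ v ⬝ᵥ v := by
  have := hP.one_sub.dotProduct_mulVec_nonneg v
  rw [sub_mulVec, one_mulVec, dotProduct_sub] at this
  linarith

theorem mulVec_residual (hP : IsOrthProj P) (v : Fin d → ℝ) : P *ᵥ (v - P *ᵥ v) = 0 := by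
  rw [mulVec_sub, hP.mulVec_mulVec, sub_self]

theorem projExtend_mul (hP : IsOrthProj P) (v : Fin d → ℝ) : projExtend P v * P = P := by
  rw [projExtend, add_mul, hP.mul_self, smul_mul, vecMulVec_mul, hP.vecMul_eq,
    hP.mulVec_residual, vecMulVec_zero, smul_zero, add_zero]

theorem projExtend (hP : IsOrthProj P) (v : Fin d → ℝ) : IsOrthProj (projExtend P v) := by
  have ht : (_root_.projExtend P v)ᵀ = _root_.projExtend P v := by
    rw [_root_.projExtend, transpose_add, transpose_smul, transpose_vecMulVec, hP.transpose_eq]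
  refine ⟨?_, ht⟩
  nth_rewrite 2 [_root_.projExtend]
  rw [mul_add, hP.projExtend_mul, Matrix.mul_smul, mul_vecMulVec, _root_.projExtend, add_mulVec,
    hP.mulVec_residual, zero_add, smul_mulVec, vecMulVec_mulVec, op_smul_eq_smul]
  congr 1
  by_cases h : (v - P *ᵥ v) ⬝ᵥ (v - P *ᵥ v) = 0
  · simp [h]
  · rw [smul_smul, inv_mul_cancel₀ h, one_smul]

theorem projExtend_mulVec_self (hP : IsOrthProj P) (v : Fin d → ℝ) :
    _root_.projExtend P v *ᵥ v = v := by
  have hx : (v - P *ᵥ v) ⬝ᵥ v = (v - P *ᵥ v) ⬝ᵥ (v - P *ᵥ v) := by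
    rw [dotProduct_sub (v - P *ᵥ v) v, dotProduct_mulVec, hP.vecMul_eq, hP.mulVec_residual,
      zero_dotProduct, sub_zero]
  rw [_root_.projExtend, add_mulVec, smul_mulVec, vecMulVec_mulVec, op_smul_eq_smul, hx]
  by_cases h : (v - P *ᵥ v) ⬝ᵥ (v - P *ᵥ v) = 0
  · have h0 : v - P *ᵥ v = 0 := dotProduct_self_eq_zero.mp h
    rw [h0]
    simpa using (sub_eq_zero.mp h0).symm
  · rw [smul_smul, inv_mul_cancel₀ h, one_smul, add_sub_cancel]

/-- The determinant of `a P + b (1 - P)`, which is `a ^ rank P * b ^ (d - rank P)`, changes by at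
most the factor `a / b` when `P` is extended by one vector. -/
theorem det_projExtend (hP : IsOrthProj P) (v : Fin d → ℝ) {a b : ℝ} (ha : 0 < a) (hab : a ≤ b)
    (hdet : 0 ≤ (a • P + b • (1 - P)).det) :
    (a / b) * (a • P + b • (1 - P)).det ≤
      (a • _root_.projExtend P v + b • (1 - _root_.projExtend P v)).det := by
  have hb : 0 < b := ha.trans_le hab
  set x := v - P *ᵥ v with hx
  set c := (x ⬝ᵥ x)⁻¹ with hc
  have hPx : P *ᵥ x = 0 := hP.mulVec_residual v
  -- `a P + b (1 - P)` acts on the residual `x` as multiplication by `b`.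
  have key : a • _root_.projExtend P v + b • (1 - _root_.projExtend P v) =
      (a • P + b • (1 - P)) * (1 + vecMulVec (((a - b) / b * c) • x) x) := by
    rw [_root_.projExtend, ← hx, ← hc, mul_add, mul_one, mul_vecMulVec, mulVec_smul, add_mulVec,
      smul_mulVec, smul_mulVec, sub_mulVec, hPx, one_mulVec, smul_zero, zero_add, sub_zero,
      smul_smul, smul_vecMulVec, mul_right_comm, div_mul_cancel₀ _ hb.ne']
    simp only [smul_add, smul_sub, sub_mul, sub_smul, smul_smul]
    abel
  have hdet1 : (1 + vecMulVec (((a - b) / b * c) • x) x).det =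
      1 + (a - b) / b * (c * (x ⬝ᵥ x)) := by
    rw [vecMulVec_eq Unit, det_one_add_replicateCol_mul_replicateRow, dotProduct_smul, smul_eq_mul,
      mul_assoc]
  rw [key, det_mul, hdet1, mul_comm]
  refine mul_le_mul_of_nonneg_left ?_ hdet
  by_cases h : x ⬝ᵥ x = 0
  · rw [h, mul_zero, mul_zero, add_zero]
    exact (div_le_one hb).mpr hab
  · rw [hc, inv_mul_cancel₀ h, mul_one, sub_div, div_self hb.ne']
    linarith

end IsOrthProj

theorem measurable_projExtend {d : ℕ} : Measurable
    fun x : Matrix (Fin d) (Fin d) ℝ × (Fin d → ℝ) => projExtend x.1 x.2 := by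
  have h1 : Measurable fun x : Matrix (Fin d) (Fin d) ℝ × (Fin d → ℝ) => x.2 - x.1 *ᵥ x.2 :=
    (by fun_prop : Continuous
      fun x : Matrix (Fin d) (Fin d) ℝ × (Fin d → ℝ) => x.2 - x.1 *ᵥ x.2).measurable
  have h2 : Measurable fun y : Fin d → ℝ => (y ⬝ᵥ y)⁻¹ :=
    (by fun_prop : Continuous fun y : Fin d → ℝ => y ⬝ᵥ y).measurable.inv
  have h3 : Measurable fun z : (Matrix (Fin d) (Fin d) ℝ × ℝ) × (Fin d → ℝ) =>
      z.1.1 + z.1.2 • vecMulVec z.2 z.2 :=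
    (by fun_prop : Continuous fun z : (Matrix (Fin d) (Fin d) ℝ × ℝ) × (Fin d → ℝ) =>
      z.1.1 + z.1.2 • vecMulVec z.2 z.2).measurable
  exact h3.comp ((measurable_fst.prodMk (h2.comp h1)).prodMk h1)

/-! ### The span of the real and imaginary parts of the queries -/

namespace QueryAlgorithm

variable {d : ℕ} {S : Type*} [MeasurableSpace S]

theorem history_succ (A : QueryAlgorithm d S) (M : Matrix (Fin d) (Fin d) ℝ) (s : S) (t : ℕ) :
    A.history M s (t + 1) =
      Fin.snoc (α := fun _ => EuclideanSpace ℂ (Fin d) × EuclideanSpace ℂ (Fin d))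
        (A.history M s t) (A.queryAt M s t, oracle M (A.queryAt M s t)) := rfl

/-- The real part of the query made after `t` rounds. -/
def queryRe (A : QueryAlgorithm d S) (M : Matrix (Fin d) (Fin d) ℝ) (s : S) (t : ℕ) :
    Fin d → ℝ :=
  fun i => (A.queryAt M s t i).re

/-- The imaginary part of the query made after `t` rounds. -/
def queryIm (A : QueryAlgorithm d S) (M : Matrix (Fin d) (Fin d) ℝ) (s : S) (t : ℕ) :
    Fin d → ℝ :=
  fun i => (A.queryAt M s t i).im

/-- The orthogonal projection onto the real span of the real and imaginary parts of the first `t`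
queries, built by Gram–Schmidt so that it is visibly measurable. -/
def spanProj (A : QueryAlgorithm d S) (M : Matrix (Fin d) (Fin d) ℝ) (s : S) :
    ℕ → Matrix (Fin d) (Fin d) ℝ
  | 0 => 0
  | t + 1 => projExtend (projExtend (A.spanProj M s t) (A.queryRe M s t)) (A.queryIm M s t)

theorem queryRe_congr {A : QueryAlgorithm d S} {M M' : Matrix (Fin d) (Fin d) ℝ} {s : S} {t : ℕ}
    (h : A.queryAt M' s t = A.queryAt M s t) : A.queryRe M' s t = A.queryRe M s t := by
  unfold queryRe; rw [h]

theorem queryIm_congr {A : QueryAlgorithm d S} {M M' : Matrix (Fin d) (Fin d) ℝ} {s : S} {t : ℕ}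
    (h : A.queryAt M' s t = A.queryAt M s t) : A.queryIm M' s t = A.queryIm M s t := by
  unfold queryIm; rw [h]

variable (A : QueryAlgorithm d S) (M M' : Matrix (Fin d) (Fin d) ℝ) (s : S)

theorem isOrthProj_spanProj (t : ℕ) : IsOrthProj (A.spanProj M s t) := by
  induction t with
  | zero => exact .zero
  | succ t ih => exact (ih.projExtend _).projExtend _

theorem spanProj_succ_mul (t : ℕ) :
    A.spanProj M s (t + 1) * A.spanProj M s t = A.spanProj M s t := by
  have h := A.isOrthProj_spanProj M s t
  rw [spanProj]
  nth_rewrite 2 [← h.projExtend_mul (A.queryRe M s t)]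
  rw [← Matrix.mul_assoc, (h.projExtend _).projExtend_mul, h.projExtend_mul]

theorem spanProj_mul_of_le {t t' : ℕ} (h : t ≤ t') :
    A.spanProj M s t' * A.spanProj M s t = A.spanProj M s t := by
  induction t', h using Nat.le_induction with
  | base => exact (A.isOrthProj_spanProj M s t).mul_self
  | succ n _ ih => rw [← ih, ← Matrix.mul_assoc, spanProj_succ_mul]

theorem spanProj_mul_of_le' {t t' : ℕ} (h : t ≤ t') :
    A.spanProj M s t * A.spanProj M s t' = A.spanProj M s t := by
  have := congrArg transpose (A.spanProj_mul_of_le M s h)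
  rwa [transpose_mul, (A.isOrthProj_spanProj M s t).transpose_eq,
    (A.isOrthProj_spanProj M s t').transpose_eq] at this

theorem spanProj_succ_mulVec_queryRe (t : ℕ) :
    A.spanProj M s (t + 1) *ᵥ A.queryRe M s t = A.queryRe M s t := by
  have h := A.isOrthProj_spanProj M s t
  rw [spanProj]
  nth_rewrite 2 [← h.projExtend_mulVec_self (A.queryRe M s t)]
  rw [Matrix.mulVec_mulVec, (h.projExtend _).projExtend_mul, h.projExtend_mulVec_self]

theorem spanProj_succ_mulVec_queryIm (t : ℕ) :
    A.spanProj M s (t + 1) *ᵥ A.queryIm M s t = A.queryIm M s t :=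
  ((A.isOrthProj_spanProj M s t).projExtend _).projExtend_mulVec_self _

theorem spanProj_mulVec_queryRe {t t' : ℕ} (h : t < t') :
    A.spanProj M s t' *ᵥ A.queryRe M s t = A.queryRe M s t := by
  rw [← A.spanProj_succ_mulVec_queryRe M s t, Matrix.mulVec_mulVec, A.spanProj_mul_of_le M s h]

theorem spanProj_mulVec_queryIm {t t' : ℕ} (h : t < t') :
    A.spanProj M s t' *ᵥ A.queryIm M s t = A.queryIm M s t := by
  rw [← A.spanProj_succ_mulVec_queryIm M s t, Matrix.mulVec_mulVec, A.spanProj_mul_of_le M s h]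

/-- The projection `P` after `t` rounds has rank at most `2 t`, in the form of a lower bound on
the determinant of `a P + b (1 - P)`. -/
theorem le_det_spanProj {a b : ℝ} (ha : 0 < a) (hab : a ≤ b) (t : ℕ) :
    b ^ d * (a / b) ^ (2 * t) ≤ (a • A.spanProj M s t + b • (1 - A.spanProj M s t)).det := by
  have hb : 0 < b := ha.trans_le hab
  induction t with
  | zero => simp [spanProj]
  | succ t ih =>
    have h := A.isOrthProj_spanProj M s t
    have h0 : 0 ≤ (a • A.spanProj M s t + b • (1 - A.spanProj M s t)).det :=
      le_trans (by positivity) ih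
    have h1 := h.det_projExtend (A.queryRe M s t) ha hab h0
    have h2 := (h.projExtend (A.queryRe M s t)).det_projExtend (A.queryIm M s t) ha hab
      (le_trans (mul_nonneg (by positivity) h0) h1)
    calc b ^ d * (a / b) ^ (2 * (t + 1))
        = a / b * (a / b * (b ^ d * (a / b) ^ (2 * t))) := by ring
      _ ≤ _ := (mul_le_mul_of_nonneg_left ((mul_le_mul_of_nonneg_left ih (by positivity)).trans h1)
          (by positivity)).trans h2

theorem oracle_apply_re (v : EuclideanSpace ℂ (Fin d)) (i : Fin d) :
    (oracle M v i).re = (M *ᵥ fun j => (v j).re) i := by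
  simp [oracle, mulVec, dotProduct]

theorem oracle_apply_im (v : EuclideanSpace ℂ (Fin d)) (i : Fin d) :
    (oracle M v i).im = (M *ᵥ fun j => (v j).im) i := by
  simp [oracle, mulVec, dotProduct]

/-- The history after `t` rounds depends on `M` only through its restriction to the span of the
queries. -/
theorem history_eq_of_mul_spanProj_eq {t : ℕ}
    (h : M * A.spanProj M s t = M' * A.spanProj M s t) :
    A.history M' s t = A.history M s t ∧ A.spanProj M' s t = A.spanProj M s t := by
  induction t with
  | zero => exact ⟨rfl, rfl⟩
  | succ t ih =>
    have h0 : M * A.spanProj M s t = M' * A.spanProj M s t := by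
      rw [← A.spanProj_succ_mul M s t, ← Matrix.mul_assoc, h, Matrix.mul_assoc]
    obtain ⟨h1, h2⟩ := ih h0
    have hq : A.queryAt M' s t = A.queryAt M s t := by rw [queryAt, h1, queryAt]
    have ho : oracle M' (A.queryAt M s t) = oracle M (A.queryAt M s t) := by
      ext i
      apply Complex.ext
      · rw [oracle_apply_re, oracle_apply_re]
        change (M' *ᵥ A.queryRe M s t) i = (M *ᵥ A.queryRe M s t) i
        rw [← A.spanProj_succ_mulVec_queryRe M s t, Matrix.mulVec_mulVec, Matrix.mulVec_mulVec, h]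
      · rw [oracle_apply_im, oracle_apply_im]
        change (M' *ᵥ A.queryIm M s t) i = (M *ᵥ A.queryIm M s t) i
        rw [← A.spanProj_succ_mulVec_queryIm M s t, Matrix.mulVec_mulVec, Matrix.mulVec_mulVec, h]
    refine ⟨?_, ?_⟩
    · rw [history_succ, history_succ, h1, hq, ho]
    · rw [spanProj, spanProj, h2, queryRe_congr hq, queryIm_congr hq]

/-- The queries up to and including the next one are determined by the answers so far. -/
theorem spanProj_succ_eq_of_mul_spanProj_eq {t : ℕ}
    (h : M * A.spanProj M s t = M' * A.spanProj M s t) :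
    A.spanProj M' s (t + 1) = A.spanProj M s (t + 1) := by
  obtain ⟨h1, h2⟩ := A.history_eq_of_mul_spanProj_eq M M' s h
  have hq : A.queryAt M' s t = A.queryAt M s t := by rw [queryAt, h1, queryAt]
  rw [spanProj, spanProj, h2, queryRe_congr hq, queryIm_congr hq]

theorem measurable_oracle : Measurable
    fun x : Matrix (Fin d) (Fin d) ℝ × EuclideanSpace ℂ (Fin d) => oracle x.1 x.2 := by
  have h : Continuous fun x : Matrix (Fin d) (Fin d) ℝ × EuclideanSpace ℂ (Fin d) =>
      x.1.map Complex.ofReal *ᵥ x.2.ofLp :=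
    Continuous.matrix_mulVec (continuous_fst.matrix_map Complex.continuous_ofReal)
      ((PiLp.continuous_ofLp 2 fun _ : Fin d => ℂ).comp continuous_snd)
  exact ((PiLp.continuous_toLp 2 fun _ : Fin d => ℂ).comp h).measurable

theorem measurable_history (t : ℕ) : Measurable
    fun x : Matrix (Fin d) (Fin d) ℝ × S => A.history x.1 x.2 t := by
  induction t with
  | zero => exact measurable_const
  | succ t ih =>
    have hq : Measurable fun x : Matrix (Fin d) (Fin d) ℝ × S => A.queryAt x.1 x.2 t :=
      (A.measurable_query t).comp (measurable_snd.prodMk ih)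
    have ho : Measurable fun x : Matrix (Fin d) (Fin d) ℝ × S =>
        oracle x.1 (A.queryAt x.1 x.2 t) := by
      have hp : Measurable fun x : Matrix (Fin d) (Fin d) ℝ × S => (x.1, A.queryAt x.1 x.2 t) :=
        measurable_fst.prodMk hq
      have := measurable_oracle.comp hp
      exact this
    refine measurable_pi_iff.mpr fun i => ?_
    simp only [history_succ]
    refine Fin.lastCases ?_ (fun j => ?_) i
    · simp only [Fin.snoc_last]
      exact hq.prodMk ho
    · simp only [Fin.snoc_castSucc]
      exact measurable_pi_iff.mp ih j

theorem measurable_queryAt (t : ℕ) : Measurable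
    fun x : Matrix (Fin d) (Fin d) ℝ × S => A.queryAt x.1 x.2 t :=
  (A.measurable_query t).comp (measurable_snd.prodMk (A.measurable_history t))

theorem measurable_spanProj (t : ℕ) : Measurable
    fun x : Matrix (Fin d) (Fin d) ℝ × S => A.spanProj x.1 x.2 t := by
  have hq (t : ℕ) (i : Fin d) : Measurable
      fun x : Matrix (Fin d) (Fin d) ℝ × S => A.queryAt x.1 x.2 t i :=
    (by fun_prop : Measurable fun v : EuclideanSpace ℂ (Fin d) => v i).comp
      (A.measurable_queryAt t)
  induction t with
  | zero => exact measurable_const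
  | succ t ih =>
    have hre : Measurable fun x : Matrix (Fin d) (Fin d) ℝ × S => A.queryRe x.1 x.2 t :=
      measurable_pi_iff.mpr fun i => Complex.measurable_re.comp (hq t i)
    have him : Measurable fun x : Matrix (Fin d) (Fin d) ℝ × S => A.queryIm x.1 x.2 t :=
      measurable_pi_iff.mpr fun i => Complex.measurable_im.comp (hq t i)
    exact measurable_projExtend.comp
      ((measurable_projExtend.comp (ih.prodMk hre)).prodMk him)

end QueryAlgorithm

/-! ### Change of measure along the queries -/

/-- The Cameron–Martin formula for a shift of rank one. -/
theorem lintegral_ginOE_add_vecMulVec {d : ℕ} (hd : 1 ≤ d) (lam : ℝ) {u : Fin d → ℝ}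
    (hu : u ⬝ᵥ u = 1) (w : Fin d → ℝ)
    {H : Matrix (Fin d) (Fin d) ℝ → ℝ≥0∞} (hH : Measurable H) :
    ∫⁻ G, H (of G + lam • vecMulVec u w) ∂ginOE d =
      ∫⁻ G, ENNReal.ofReal (Real.exp
        (d * lam * ((of G *ᵥ w) ⬝ᵥ u) - d / 2 * lam ^ 2 * (w ⬝ᵥ w))) * H (of G) ∂ginOE d := by
  rw [lintegral_ginOE_add hd _ hH]
  refine lintegral_congr fun G => ?_
  have h1 : trace (of G * (lam • vecMulVec u w)ᵀ) = lam * ((of G *ᵥ w) ⬝ᵥ u) := by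
    rw [transpose_smul, transpose_vecMulVec, Matrix.mul_smul, mul_vecMulVec, trace_smul,
      trace_vecMulVec, smul_eq_mul]
  have h2 : trace ((lam • vecMulVec u w) * (lam • vecMulVec u w)ᵀ) = lam ^ 2 * (w ⬝ᵥ w) := by
    rw [transpose_smul, transpose_vecMulVec, Matrix.mul_smul, smul_mul, mul_vecMulVec,
      vecMulVec_mulVec, op_smul_eq_smul, smul_vecMulVec, trace_smul, trace_smul, trace_smul,
      trace_vecMulVec, hu, smul_eq_mul, smul_eq_mul, smul_eq_mul]
    ring
  rw [h1, h2]
  congr 4 <;> ring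

theorem lintegral_exp_ginOE {d : ℕ} (hd : 1 ≤ d) (lam : ℝ) {u : Fin d → ℝ}
    (hu : u ⬝ᵥ u = 1) (w : Fin d → ℝ) :
    ∫⁻ G, ENNReal.ofReal (Real.exp
        (d * lam * ((of G *ᵥ w) ⬝ᵥ u) - d / 2 * lam ^ 2 * (w ⬝ᵥ w))) ∂ginOE d = 1 := by
  have := lintegral_ginOE_add_vecMulVec hd lam hu w (H := fun _ => 1) measurable_const
  simpa using this.symm

namespace QueryAlgorithm

variable {d : ℕ} {S : Type*} [MeasurableSpace S]

theorem measurable_spanProj_left (A : QueryAlgorithm d S) (s : S) (t : ℕ) :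
    Measurable fun M => A.spanProj M s t := by
  have := (A.measurable_spanProj t).comp (measurable_id.prodMk (measurable_const (a := s)))
  exact this

/-- Given the answers to the first `t` queries, the restriction of a Ginibre matrix to the
orthogonal complement of the queries is still Ginibre: it may be replaced by that of an independent
copy without changing the law. -/
theorem lintegral_ginOE_resample_spanProj (hd : 1 ≤ d) (A : QueryAlgorithm d S) (s : S) (t : ℕ)
    {H : Matrix (Fin d) (Fin d) ℝ → ℝ≥0∞} (hH : Measurable H) :
    ∫⁻ G, H (of G) ∂ginOE d =
      ∫⁻ G, ∫⁻ G', H (of G * A.spanProj (of G) s t + of G' * (1 - A.spanProj (of G) s t))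
        ∂ginOE d ∂ginOE d := by
  induction t generalizing H with
  | zero => simp [spanProj]
  | succ t ih =>
    set K : Matrix (Fin d) (Fin d) ℝ → ℝ≥0∞ := fun M =>
      ∫⁻ G', H (M * A.spanProj M s (t + 1) + of G' * (1 - A.spanProj M s (t + 1))) ∂ginOE d with hK
    have hKm : Measurable K := by
      have h1 : Measurable fun z : (Matrix (Fin d) (Fin d) ℝ × Matrix (Fin d) (Fin d) ℝ) ×
          (Matrix (Fin d) (Fin d) ℝ) => z.1.1 * z.1.2 + z.2 * (1 - z.1.2) :=
        (by fun_prop : Continuous fun z : (Matrix (Fin d) (Fin d) ℝ × Matrix (Fin d) (Fin d) ℝ) ×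
          (Matrix (Fin d) (Fin d) ℝ) => z.1.1 * z.1.2 + z.2 * (1 - z.1.2)).measurable
      have h2 : Measurable fun z : Matrix (Fin d) (Fin d) ℝ × (Fin d → Fin d → ℝ) =>
          ((z.1, A.spanProj z.1 s (t + 1)), of z.2) :=
        (measurable_fst.prodMk ((A.measurable_spanProj_left s (t + 1)).comp measurable_fst)).prodMk
          (measurable_of.comp measurable_snd)
      have h3 := hH.comp (h1.comp h2)
      exact h3.lintegral_prod_right'
    rw [ih hH]
    change _ = ∫⁻ G, K (of G) ∂ginOE d
    rw [ih hKm]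
    refine lintegral_congr fun G => ?_
    set P := A.spanProj (of G) s t with hPdef
    set E := A.spanProj (of G) s (t + 1) with hEdef
    have hP : IsOrthProj P := A.isOrthProj_spanProj _ s t
    have hE : IsOrthProj E := A.isOrthProj_spanProj _ s (t + 1)
    have hEP : E * P = P := A.spanProj_succ_mul _ s t
    have hPE : P * E = P := A.spanProj_mul_of_le' _ s (Nat.le_succ t)
    have hHm : Measurable fun X : Matrix (Fin d) (Fin d) ℝ => H (of G * P + X * (1 - P)) :=
      hH.comp (by fun_prop : Continuous fun X : Matrix (Fin d) (Fin d) ℝ =>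
        of G * P + X * (1 - P)).measurable
    -- Given `G`, the next projection `E` is fixed, so the fresh copy may itself be split along `E`.
    rw [lintegral_ginOE_resample hd hE.mul_self hE.transpose_eq hHm]
    refine lintegral_congr fun G' => ?_
    -- Replacing `G (1 - P)` by `G' (1 - P)` does not affect the first `t` answers.
    have hloc : A.spanProj (of G * P + of G' * (1 - P)) s (t + 1) = E := by
      refine A.spanProj_succ_eq_of_mul_spanProj_eq _ _ s ?_
      rw [← hPdef, add_mul, Matrix.mul_assoc, Matrix.mul_assoc, sub_mul, hP.mul_self, one_mul,
        sub_self, mul_zero, add_zero]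
    rw [hK]
    simp only [hloc]
    refine lintegral_congr fun G'' => ?_
    congr 1
    simp only [add_mul, mul_sub, sub_mul, Matrix.mul_assoc, hEP, hPE, Matrix.mul_one]
    abel

/-- The weight `‖P u‖²` of the vector `u` on the span of the first `t` queries. -/
def spanOverlap (A : QueryAlgorithm d S) (M : Matrix (Fin d) (Fin d) ℝ) (s : S) (t : ℕ)
    (u : Fin d → ℝ) : ℝ :=
  u ⬝ᵥ (A.spanProj M s t *ᵥ u)

/-- The likelihood ratio, after `t` rounds, of the spiked matrix `G + lam u uᵀ` against `G`. -/
def likelihood (A : QueryAlgorithm d S) (s : S) (t : ℕ) (lam : ℝ) (u : Fin d → ℝ)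
    (G : Matrix (Fin d) (Fin d) ℝ) : ℝ :=
  Real.exp (d * lam * ((G *ᵥ (A.spanProj G s t *ᵥ u)) ⬝ᵥ u) -
    d / 2 * lam ^ 2 * A.spanOverlap G s t u)

/-- The likelihood ratio formula for statistics `F` of the first `t` rounds. -/
theorem lintegral_ginOE_spiked (hd : 1 ≤ d) (A : QueryAlgorithm d S) (s : S) (t : ℕ) (lam : ℝ)
    {u : Fin d → ℝ} (hu : u ⬝ᵥ u = 1)
    {F : Matrix (Fin d) (Fin d) ℝ → ℝ≥0∞} (hF : Measurable F)
    (hloc : ∀ M M', M * A.spanProj M s t = M' * A.spanProj M s t → F M' = F M) :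
    ∫⁻ G, F (of G + lam • vecMulVec u u) ∂ginOE d =
      ∫⁻ G, F (of G) * ENNReal.ofReal (A.likelihood s t lam u (of G)) ∂ginOE d := by
  rw [lintegral_ginOE_add_vecMulVec hd lam hu u hF]
  have hm : Measurable fun M : Matrix (Fin d) (Fin d) ℝ => ENNReal.ofReal (Real.exp
      (d * lam * ((M *ᵥ u) ⬝ᵥ u) - d / 2 * lam ^ 2 * (u ⬝ᵥ u))) * F M :=
    (ENNReal.measurable_ofReal.comp (by fun_prop : Continuous fun M : Matrix (Fin d) (Fin d) ℝ =>
      Real.exp (d * lam * ((M *ᵥ u) ⬝ᵥ u) - d / 2 * lam ^ 2 * (u ⬝ᵥ u))).measurable).mul hF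
  rw [A.lintegral_ginOE_resample_spanProj hd s t hm]
  refine lintegral_congr fun G => ?_
  set P := A.spanProj (of G) s t with hPdef
  have hP : IsOrthProj P := A.isOrthProj_spanProj _ s t
  have hFG : ∀ G' : Matrix (Fin d) (Fin d) ℝ, F (of G * P + G' * (1 - P)) = F (of G) := by
    intro G'
    refine hloc _ _ ?_
    rw [← hPdef, add_mul, Matrix.mul_assoc, Matrix.mul_assoc, sub_mul, hP.mul_self, one_mul,
      sub_self, mul_zero, add_zero]
  have hexp : ∀ G' : Matrix (Fin d) (Fin d) ℝ, ENNReal.ofReal (Real.exp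
      (d * lam * (((of G * P + G' * (1 - P)) *ᵥ u) ⬝ᵥ u) - d / 2 * lam ^ 2 * (u ⬝ᵥ u))) =
      ENNReal.ofReal (A.likelihood s t lam u (of G)) * ENNReal.ofReal (Real.exp
        (d * lam * ((G' *ᵥ ((1 - P) *ᵥ u)) ⬝ᵥ u) -
          d / 2 * lam ^ 2 * (((1 - P) *ᵥ u) ⬝ᵥ ((1 - P) *ᵥ u)))) := by
    intro G'
    rw [likelihood, spanOverlap, ← hPdef, ← ENNReal.ofReal_mul (Real.exp_pos _).le, ← Real.exp_add,
      ← hP.one_sub.dotProduct_mulVec_eq, add_mulVec, add_dotProduct, Matrix.mulVec_mulVec,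
      Matrix.mulVec_mulVec, sub_mulVec, one_mulVec, dotProduct_sub]
    congr 2
    ring
  simp only [hFG, hexp]
  have hm' : Measurable fun G' : Fin d → Fin d → ℝ => ENNReal.ofReal (Real.exp
        (d * lam * ((of G' *ᵥ ((1 - P) *ᵥ u)) ⬝ᵥ u) -
          d / 2 * lam ^ 2 * (((1 - P) *ᵥ u) ⬝ᵥ ((1 - P) *ᵥ u)))) :=
    ENNReal.measurable_ofReal.comp ((by fun_prop : Continuous fun M : Matrix (Fin d) (Fin d) ℝ =>
      Real.exp (d * lam * ((M *ᵥ ((1 - P) *ᵥ u)) ⬝ᵥ u) -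
          d / 2 * lam ^ 2 * (((1 - P) *ᵥ u) ⬝ᵥ ((1 - P) *ᵥ u)))).measurable.comp measurable_of)
  rw [lintegral_mul_const _ (hm'.const_mul _), lintegral_const_mul _ hm',
    lintegral_exp_ginOE hd lam hu, mul_one, mul_comm]

theorem lintegral_likelihood (hd : 1 ≤ d) (A : QueryAlgorithm d S) (s : S) (t : ℕ) (lam : ℝ)
    {u : Fin d → ℝ} (hu : u ⬝ᵥ u = 1) :
    ∫⁻ G, ENNReal.ofReal (A.likelihood s t lam u (of G)) ∂ginOE d = 1 := by
  have := A.lintegral_ginOE_spiked hd s t lam hu (F := fun _ => 1) measurable_const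
    fun _ _ _ => rfl
  simpa using this.symm

/-- A power of the likelihood ratio is the likelihood ratio of a larger spike, up to a factor
that depends only on the overlap. -/
theorem likelihood_rpow (A : QueryAlgorithm d S) (s : S) (t : ℕ) (lam p : ℝ) (u : Fin d → ℝ)
    (G : Matrix (Fin d) (Fin d) ℝ) :
    A.likelihood s t lam u G ^ p = A.likelihood s t (p * lam) u G *
      Real.exp (d / 2 * lam ^ 2 * (p * (p - 1)) * A.spanOverlap G s t u) := by
  rw [likelihood, likelihood, ← Real.exp_mul, ← Real.exp_add]
  congr 1
  ring

theorem measurable_spanOverlap (A : QueryAlgorithm d S) (t : ℕ) :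
    Measurable fun x : (Matrix (Fin d) (Fin d) ℝ × S) × (Fin d → ℝ) =>
      A.spanOverlap x.1.1 x.1.2 t x.2 := by
  have h1 : Measurable fun z : Matrix (Fin d) (Fin d) ℝ × (Fin d → ℝ) => z.2 ⬝ᵥ (z.1 *ᵥ z.2) :=
    (by fun_prop : Continuous
      fun z : Matrix (Fin d) (Fin d) ℝ × (Fin d → ℝ) => z.2 ⬝ᵥ (z.1 *ᵥ z.2)).measurable
  have := h1.comp (((A.measurable_spanProj t).comp measurable_fst).prodMk measurable_snd)
  exact this

theorem measurable_likelihood (A : QueryAlgorithm d S) (s : S) (t : ℕ) (lam : ℝ) :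
    Measurable fun x : Matrix (Fin d) (Fin d) ℝ × (Fin d → ℝ) =>
      A.likelihood s t lam x.2 x.1 := by
  have h1 : Measurable
      fun z : (Matrix (Fin d) (Fin d) ℝ × (Fin d → ℝ)) × Matrix (Fin d) (Fin d) ℝ =>
      Real.exp (d * lam * ((z.1.1 *ᵥ (z.2 *ᵥ z.1.2)) ⬝ᵥ z.1.2) -
        d / 2 * lam ^ 2 * (z.1.2 ⬝ᵥ (z.2 *ᵥ z.1.2))) :=
    (by fun_prop : Continuous
      fun z : (Matrix (Fin d) (Fin d) ℝ × (Fin d → ℝ)) × Matrix (Fin d) (Fin d) ℝ =>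
      Real.exp (d * lam * ((z.1.1 *ᵥ (z.2 *ᵥ z.1.2)) ⬝ᵥ z.1.2) -
        d / 2 * lam ^ 2 * (z.1.2 ⬝ᵥ (z.2 *ᵥ z.1.2)))).measurable
  have := h1.comp (measurable_id.prodMk ((A.measurable_spanProj_left s t).comp measurable_fst))
  exact this

end QueryAlgorithm

/-! ### One round of information gain -/

namespace QueryAlgorithm

variable {d : ℕ} {S : Type*} [MeasurableSpace S]

/-- On the event that the overlap is at most `c`, the moment of order `lam` of the likelihood
ratio is at most exponential in `c`. -/
theorem lintegral_indicator_likelihood_rpow_le (hd : 1 ≤ d) (A : QueryAlgorithm d S) (s : S) (t : ℕ)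
    {lam : ℝ} (hlam : 1 < lam) (c : ℝ) {u : Fin d → ℝ} (hu : u ⬝ᵥ u = 1) :
    ∫⁻ G, ({M | A.spanOverlap M s t u ≤ c}.indicator
        (fun M => ENNReal.ofReal (A.likelihood s t lam u M)) (of G)) ^ lam ∂ginOE d ≤
      ENNReal.ofReal (Real.exp (d / 2 * lam ^ 2 * (lam * (lam - 1)) * c)) := by
  have hpos : 0 < lam := by linarith
  calc _ ≤ ∫⁻ G, ENNReal.ofReal (A.likelihood s t (lam * lam) u (of G)) *
        ENNReal.ofReal (Real.exp (d / 2 * lam ^ 2 * (lam * (lam - 1)) * c)) ∂ginOE d := by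
        refine lintegral_mono fun G => ?_
        have hnn : 0 ≤ A.likelihood s t lam u (of G) := (Real.exp_pos _).le
        have hnn' : 0 ≤ A.likelihood s t (lam * lam) u (of G) := (Real.exp_pos _).le
        by_cases h : A.spanOverlap (of G) s t u ≤ c
        · rw [Set.indicator_of_mem (by exact h), ENNReal.ofReal_rpow_of_nonneg
            hnn hpos.le, likelihood_rpow, ENNReal.ofReal_mul hnn']
          have hl : 0 ≤ lam * (lam - 1) := mul_nonneg hpos.le (by linarith)
          dsimp only
          gcongr
        · rw [Set.indicator_of_notMem (by exact h), ENNReal.zero_rpow_of_pos hpos]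
          exact zero_le
    _ = _ := by
        rw [lintegral_mul_const' _ _ ENNReal.ofReal_ne_top, A.lintegral_likelihood hd s t _ hu,
          one_mul]

/-- If the spike `v` is drawn at random, the probability that the overlap jumps from below `c` to
above `c'` in one round is controlled by the probability `ε` that an overlap above `c'` occurs for
queries independent of the spike. -/
theorem lintegral_measure_jump_le (hd : 1 ≤ d) (A : QueryAlgorithm d S) (s : S) (t : ℕ)
    {lam : ℝ} (hlam : 1 < lam) (c c' : ℝ) {ε : ℝ≥0∞} {U : Type*} [MeasurableSpace U] (σ : Measure U)
    [IsProbabilityMeasure σ] {v : U → Fin d → ℝ} (hv : Measurable v) (hv1 : ∀ a, v a ⬝ᵥ v a = 1)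
    (htail : ∀ M, σ {a | c' < A.spanOverlap M s (t + 1) (v a)} ≤ ε) :
    ∫⁻ a, ginOE d {G | A.spanOverlap (of G + lam • vecMulVec (v a) (v a)) s t (v a) ≤ c ∧
        c' < A.spanOverlap (of G + lam • vecMulVec (v a) (v a)) s (t + 1) (v a)} ∂σ ≤
      ε ^ (1 - lam⁻¹) * ENNReal.ofReal (Real.exp (d / 2 * lam ^ 2 * (lam - 1) * c)) := by
  have hpos : 0 < lam := by linarith
  have hov (t : ℕ) : Measurable fun x : U × Matrix (Fin d) (Fin d) ℝ =>
      A.spanOverlap x.2 s t (v x.1) := by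
    have h := (A.measurable_spanOverlap t).comp
      ((measurable_snd.prodMk (measurable_const (a := s))).prodMk (hv.comp measurable_fst) :
        Measurable fun x : U × Matrix (Fin d) (Fin d) ℝ => ((x.2, s), v x.1))
    exact h
  have hov' (t : ℕ) (a : U) : Measurable fun M : Matrix (Fin d) (Fin d) ℝ =>
      A.spanOverlap M s t (v a) := (hov t).comp (measurable_const.prodMk measurable_id)
  set f : U × Matrix (Fin d) (Fin d) ℝ → ℝ≥0∞ :=
    {x | c' < A.spanOverlap x.2 s (t + 1) (v x.1)}.indicator 1 with hf
  set g : U × Matrix (Fin d) (Fin d) ℝ → ℝ≥0∞ := {x | A.spanOverlap x.2 s t (v x.1) ≤ c}.indicator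
    fun x => ENNReal.ofReal (A.likelihood s t lam (v x.1) x.2) with hg
  have hfs : MeasurableSet {x : U × Matrix (Fin d) (Fin d) ℝ |
      c' < A.spanOverlap x.2 s (t + 1) (v x.1)} := measurableSet_lt measurable_const (hov (t + 1))
  have hfm : Measurable f := measurable_one.indicator hfs
  have hgm : Measurable g := by
    have h := (A.measurable_likelihood s t lam).comp
      (measurable_snd.prodMk (hv.comp measurable_fst) :
        Measurable fun x : U × Matrix (Fin d) (Fin d) ℝ => (x.2, v x.1))
    exact (ENNReal.measurable_ofReal.comp h).indicator (measurableSet_le (hov t) measurable_const)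
  have hof : Measurable fun z : U × (Fin d → Fin d → ℝ) => (z.1, of z.2) :=
    measurable_fst.prodMk (measurable_of.comp measurable_snd)
  -- Both overlaps are determined by the first `t` answers, so the likelihood ratio at `t` applies.
  have hstep : ∀ a, ginOE d {G | A.spanOverlap (of G + lam • vecMulVec (v a) (v a)) s t (v a) ≤ c ∧
        c' < A.spanOverlap (of G + lam • vecMulVec (v a) (v a)) s (t + 1) (v a)} =
      ∫⁻ G, f (a, of G) * g (a, of G) ∂ginOE d := by
    intro a
    set B : Set (Matrix (Fin d) (Fin d) ℝ) :=
      {M | A.spanOverlap M s t (v a) ≤ c ∧ c' < A.spanOverlap M s (t + 1) (v a)} with hB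
    have hBm : MeasurableSet B := (measurableSet_le (hov' t a) measurable_const).inter
      (measurableSet_lt measurable_const (hov' (t + 1) a))
    have hsh : Measurable fun G : Fin d → Fin d → ℝ => of G + lam • vecMulVec (v a) (v a) :=
      (by fun_prop : Continuous fun M : Matrix (Fin d) (Fin d) ℝ =>
        M + lam • vecMulVec (v a) (v a)).measurable.comp measurable_of
    have h1 := A.lintegral_ginOE_spiked hd s t lam (hv1 a) (F := B.indicator 1)
      (measurable_one.indicator hBm) fun M M' h => by
        have e1 := (A.history_eq_of_mul_spanProj_eq M M' s h).2
        have e2 := A.spanProj_succ_eq_of_mul_spanProj_eq M M' s h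
        simp only [Set.indicator, hB, Set.mem_ofPred_eq, spanOverlap, e1, e2, Pi.one_apply]
    calc _ = ∫⁻ G, B.indicator 1 (of G + lam • vecMulVec (v a) (v a)) ∂ginOE d := by
          exact (lintegral_indicator_one (hsh hBm)).symm
      _ = _ := by
          rw [h1]
          refine lintegral_congr fun G => ?_
          by_cases h2 : A.spanOverlap (of G) s t (v a) ≤ c <;>
          by_cases h3 : c' < A.spanOverlap (of G) s (t + 1) (v a) <;>
          simp [hf, hg, hB, Set.indicator, h2, h3]
  have hpq : (Real.conjExponent lam).HolderConjugate lam :=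
    (Real.HolderConjugate.conjExponent hlam).symm
  simp only [hstep]
  have hfm' : Measurable fun z : U × (Fin d → Fin d → ℝ) => f (z.1, of z.2) := hfm.comp hof
  have hgm' : Measurable fun z : U × (Fin d → Fin d → ℝ) => g (z.1, of z.2) := hgm.comp hof
  have hmul : Measurable fun z : U × (Fin d → Fin d → ℝ) => f (z.1, of z.2) * g (z.1, of z.2) :=
    hfm'.mul hgm'
  have hp : 1 / Real.conjExponent lam = 1 - lam⁻¹ := by
    rw [Real.conjExponent, one_div_div, sub_div, div_self hpos.ne', one_div]
  have hF : ∫⁻ z, f (z.1, of z.2) ^ Real.conjExponent lam ∂σ.prod (ginOE d) ≤ ε := by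
    have e : ∀ z : U × (Fin d → Fin d → ℝ), f (z.1, of z.2) ^ Real.conjExponent lam =
        f (z.1, of z.2) := by
      intro z
      by_cases h : (z.1, of z.2) ∈ {x : U × Matrix (Fin d) (Fin d) ℝ |
        c' < A.spanOverlap x.2 s (t + 1) (v x.1)}
      · rw [hf, Set.indicator_of_mem h]; simp
      · rw [hf, Set.indicator_of_notMem h, ENNReal.zero_rpow_of_pos hpq.pos]
    simp only [e]
    rw [lintegral_prod_symm _ hfm'.aemeasurable]
    calc _ ≤ ∫⁻ _, ε ∂ginOE d := by
          refine lintegral_mono fun G => ?_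
          refine le_trans (le_of_eq ?_) (htail (of G))
          rw [← lintegral_indicator_one]
          · rfl
          · exact measurableSet_lt measurable_const
              ((hov (t + 1)).comp (measurable_id.prodMk measurable_const))
      _ = ε := by simp
  have hG : ∫⁻ z, g (z.1, of z.2) ^ lam ∂σ.prod (ginOE d) ≤
      ENNReal.ofReal (Real.exp (d / 2 * lam ^ 2 * (lam * (lam - 1)) * c)) := by
    rw [lintegral_prod _ (hgm'.pow_const lam).aemeasurable]
    calc _ ≤ ∫⁻ _, ENNReal.ofReal (Real.exp (d / 2 * lam ^ 2 * (lam * (lam - 1)) * c)) ∂σ :=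
          lintegral_mono fun a =>
            A.lintegral_indicator_likelihood_rpow_le hd s t hlam c (hv1 a)
      _ = _ := by simp
  calc _ = ∫⁻ z, f (z.1, of z.2) * g (z.1, of z.2) ∂σ.prod (ginOE d) :=
        (lintegral_prod _ hmul.aemeasurable).symm
    _ ≤ (∫⁻ z, f (z.1, of z.2) ^ Real.conjExponent lam ∂σ.prod (ginOE d)) ^
          (1 / Real.conjExponent lam) *
        (∫⁻ z, g (z.1, of z.2) ^ lam ∂σ.prod (ginOE d)) ^ (1 / lam) :=
        ENNReal.lintegral_mul_le_Lp_mul_Lq _ hpq hfm'.aemeasurable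
          hgm'.aemeasurable
    _ ≤ ε ^ (1 - lam⁻¹) * ENNReal.ofReal (Real.exp (d / 2 * lam ^ 2 * (lam - 1) * c)) := by
        rw [hp]
        have h0 : 0 ≤ 1 - lam⁻¹ := by rw [← hp]; exact hpq.one_div_nonneg
        refine mul_le_mul' (ENNReal.rpow_le_rpow hF h0) ?_
        refine (ENNReal.rpow_le_rpow hG (by positivity)).trans (le_of_eq ?_)
        rw [ENNReal.ofReal_rpow_of_pos (Real.exp_pos _), ← Real.exp_mul]
        congr 2
        field_simp

end QueryAlgorithm

/-! ### Projections of a uniform unit vector -/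

theorem EuclideanSpace.ofLp_dotProduct_self {d : ℕ} (x : EuclideanSpace ℝ (Fin d)) :
    x.ofLp ⬝ᵥ x.ofLp = ‖x‖ ^ 2 := by
  rw [EuclideanSpace.real_norm_sq_eq, dotProduct]
  exact Finset.sum_congr rfl fun i _ => (sq _).symm

theorem EuclideanSpace.sphere_dotProduct_self {d : ℕ}
    (u : Metric.sphere (0 : EuclideanSpace ℝ (Fin d)) 1) :
    u.1.ofLp ⬝ᵥ u.1.ofLp = 1 := by
  rw [EuclideanSpace.ofLp_dotProduct_self, norm_eq_of_mem_sphere, one_pow]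

/-- The radial factor of the standard Gaussian weight in polar coordinates. -/
def radialGaussian (d : ℕ) : ℝ≥0∞ :=
  ∫⁻ r, ENNReal.ofReal (Real.exp (-(r.1 ^ 2) / 2)) ∂Measure.volumeIoiPow (d - 1)

section Polar

variable {d : ℕ}

/-- The Gaussian weight of the cone over a set of unit vectors, in polar coordinates. -/
theorem toSphere_mul_radialGaussian (s : Set (Metric.sphere (0 : EuclideanSpace ℝ (Fin d)) 1))
    (hs : MeasurableSet s) :
    (volume : Measure (EuclideanSpace ℝ (Fin d))).toSphere s * radialGaussian d =
      ∫⁻ x : ({0}ᶜ : Set (EuclideanSpace ℝ (Fin d))),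
        s.indicator 1 (homeomorphUnitSphereProd _ x).1 *
          ENNReal.ofReal (Real.exp (-(‖x.1‖ ^ 2) / 2))
        ∂(volume.comap Subtype.val) := by
  have hmeas : Measurable fun r : Set.Ioi (0 : ℝ) => ENNReal.ofReal (Real.exp (-(r.1 ^ 2) / 2)) :=
    ENNReal.measurable_ofReal.comp (by fun_prop : Continuous fun r : Set.Ioi (0 : ℝ) =>
      Real.exp (-(r.1 ^ 2) / 2)).measurable
  have h1 : Measurable fun z : Metric.sphere (0 : EuclideanSpace ℝ (Fin d)) 1 × Set.Ioi (0 : ℝ) =>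
      s.indicator (1 : Metric.sphere (0 : EuclideanSpace ℝ (Fin d)) 1 → ℝ≥0∞) z.1 *
        ENNReal.ofReal (Real.exp (-(z.2.1 ^ 2) / 2)) :=
    ((measurable_one.indicator hs).comp measurable_fst).mul (hmeas.comp measurable_snd)
  have h := (volume : Measure (EuclideanSpace ℝ (Fin d))).measurePreserving_homeomorphUnitSphereProd
  have h2 := h.lintegral_comp h1
  simp only [homeomorphUnitSphereProd_apply_snd_coe] at h2
  rw [h2, lintegral_prod_mul (measurable_one.indicator hs).aemeasurable hmeas.aemeasurable,
    lintegral_indicator_one hs, radialGaussian, finrank_euclideanSpace_fin]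

/-- The normalising constant of the standard Gaussian is positive and finite, so it cancels. -/
theorem lintegral_exp_neg_norm_sq_pos_and_lt_top :
    0 < ∫⁻ x : EuclideanSpace ℝ (Fin d), ENNReal.ofReal (Real.exp (-(‖x‖ ^ 2) / 2)) ∧
      ∫⁻ x : EuclideanSpace ℝ (Fin d), ENNReal.ofReal (Real.exp (-(‖x‖ ^ 2) / 2)) < ∞ := by
  have h := GaussianFourier.integral_rexp_neg_mul_sq_norm (V := EuclideanSpace ℝ (Fin d))
    (b := 1 / 2) (by norm_num)
  have hpos : 0 < ∫ x : EuclideanSpace ℝ (Fin d), Real.exp (-(1 / 2) * ‖x‖ ^ 2) := by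
    rw [h]; positivity
  have hint : Integrable fun x : EuclideanSpace ℝ (Fin d) => Real.exp (-(1 / 2) * ‖x‖ ^ 2) :=
    not_imp_comm.1 integral_undef hpos.ne'
  have e : (fun x : EuclideanSpace ℝ (Fin d) => ENNReal.ofReal (Real.exp (-(‖x‖ ^ 2) / 2))) =
      fun x => ENNReal.ofReal (Real.exp (-(1 / 2) * ‖x‖ ^ 2)) := by
    ext x; congr 2; ring
  rw [e, ← ofReal_integral_eq_lintegral_ofReal hint
    (Filter.Eventually.of_forall fun x => (Real.exp_pos _).le)]
  exact ⟨ENNReal.ofReal_pos.mpr hpos, ENNReal.ofReal_lt_top⟩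

/-- The Gaussian integral of the quadratic form `‖L x‖²`, by a linear change of variables. -/
theorem lintegral_exp_neg_mulVec_sq {L : Matrix (Fin d) (Fin d) ℝ} (hL : L.det ≠ 0) :
    ∫⁻ x : EuclideanSpace ℝ (Fin d),
        ENNReal.ofReal (Real.exp (-((L *ᵥ x.ofLp) ⬝ᵥ (L *ᵥ x.ofLp)) / 2)) =
      ENNReal.ofReal |L.det⁻¹| *
        ∫⁻ x : EuclideanSpace ℝ (Fin d), ENNReal.ofReal (Real.exp (-(‖x‖ ^ 2) / 2)) := by
  set g : (Fin d → ℝ) → ℝ≥0∞ := fun y => ENNReal.ofReal (Real.exp (-(y ⬝ᵥ y) / 2)) with hg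
  have hgm : Measurable g := ENNReal.measurable_ofReal.comp
    (by fun_prop : Continuous fun y : Fin d → ℝ => Real.exp (-(y ⬝ᵥ y) / 2)).measurable
  have hLm : Measurable (toLin' L) :=
    (LinearMap.continuous_of_finiteDimensional (toLin' L)).measurable
  have hv := PiLp.volume_preserving_ofLp (Fin d)
  calc _ = ∫⁻ x : EuclideanSpace ℝ (Fin d), g (toLin' L x.ofLp) := rfl
    _ = ∫⁻ y : Fin d → ℝ, g (toLin' L y) := hv.lintegral_comp (hgm.comp hLm)
    _ = ∫⁻ y, g y ∂(volume.map (toLin' L)) := (lintegral_map hgm hLm).symm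
    _ = ENNReal.ofReal |L.det⁻¹| * ∫⁻ y, g y := by
        rw [Real.map_matrix_volume_pi_eq_smul_volume_pi hL, lintegral_smul_measure, smul_eq_mul]
    _ = ENNReal.ofReal |L.det⁻¹| * ∫⁻ x : EuclideanSpace ℝ (Fin d), g x.ofLp := by
        rw [hv.lintegral_comp hgm]
    _ = _ := by simp only [hg, EuclideanSpace.ofLp_dotProduct_self]

/-- If the quadratic form `‖L u‖²` is at most one on a set of unit vectors, the uniform measure of
the set is at most `1 / |det L|`: compare the Gaussian weights `exp (-‖L x‖² / 2)` and
`exp (-‖x‖² / 2)` on the cone over the set. -/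
theorem sphereUniform_le_of_mulVec_le (hd : 1 ≤ d) {L : Matrix (Fin d) (Fin d) ℝ} (hL : L.det ≠ 0)
    {s : Set (Metric.sphere (0 : EuclideanSpace ℝ (Fin d)) 1)} (hs : MeasurableSet s)
    (hle : ∀ u ∈ s, (L *ᵥ u.1.ofLp) ⬝ᵥ (L *ᵥ u.1.ofLp) ≤ 1) :
    sphereUniform d s ≤ ENNReal.ofReal |L.det⁻¹| := by
  have : Nonempty (Fin d) := ⟨⟨0, hd⟩⟩
  set T := (volume : Measure (EuclideanSpace ℝ (Fin d))).toSphere with hT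
  obtain ⟨hpos, hfin⟩ := lintegral_exp_neg_norm_sq_pos_and_lt_top (d := d)
  have hms : MeasurableSet ({0}ᶜ : Set (EuclideanSpace ℝ (Fin d))) :=
    (measurableSet_singleton _).compl
  have huniv : T Set.univ * radialGaussian d =
      ∫⁻ x : EuclideanSpace ℝ (Fin d), ENNReal.ofReal (Real.exp (-(‖x‖ ^ 2) / 2)) := by
    rw [toSphere_mul_radialGaussian _ .univ]
    simp only [Set.indicator_univ, Pi.one_apply, one_mul]
    rw [lintegral_subtype_comap hms
      fun x : EuclideanSpace ℝ (Fin d) => ENNReal.ofReal (Real.exp (-(‖x‖ ^ 2) / 2)),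
      restrict_compl_singleton]
  have hcone : T s * radialGaussian d ≤ ∫⁻ x : EuclideanSpace ℝ (Fin d),
        ENNReal.ofReal (Real.exp (-((L *ᵥ x.ofLp) ⬝ᵥ (L *ᵥ x.ofLp)) / 2)) := by
    rw [toSphere_mul_radialGaussian _ hs]
    refine le_trans ?_ (setLIntegral_le_lintegral ({0}ᶜ : Set (EuclideanSpace ℝ (Fin d))) _)
    rw [← lintegral_subtype_comap hms]
    refine lintegral_mono fun x => ?_
    by_cases hx : (homeomorphUnitSphereProd (EuclideanSpace ℝ (Fin d)) x).1 ∈ s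
    · rw [Set.indicator_of_mem hx, Pi.one_apply, one_mul]
      have h := hle _ hx
      rw [homeomorphUnitSphereProd_apply_fst_coe] at h
      have hn : 0 < ‖x.1‖ := norm_pos_iff.mpr x.2
      rw [WithLp.ofLp_smul, mulVec_smul, smul_dotProduct, dotProduct_smul, smul_eq_mul,
        smul_eq_mul, ← mul_assoc, ← mul_inv, ← sq, inv_mul_le_one₀ (by positivity)] at h
      refine ENNReal.ofReal_le_ofReal (Real.exp_le_exp.mpr ?_)
      linarith
    · rw [Set.indicator_of_notMem hx, zero_mul]
      exact zero_le
  rw [lintegral_exp_neg_mulVec_sq hL, ← huniv, ← mul_assoc] at hcone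
  rw [← huniv] at hpos hfin
  have hZ0 : radialGaussian d ≠ 0 := right_ne_zero_of_mul hpos.ne'
  have hT0 : T Set.univ ≠ 0 := left_ne_zero_of_mul hpos.ne'
  have hTt : T Set.univ ≠ ∞ := measure_ne_top _ _
  have hZt : radialGaussian d ≠ ∞ := fun h => by
    rw [h, ENNReal.mul_top hT0] at hfin
    exact lt_irrefl _ hfin
  have h := (ENNReal.mul_le_mul_iff_left hZ0 hZt).mp hcone
  calc sphereUniform d s = (T Set.univ)⁻¹ * T s := rfl
    _ ≤ (T Set.univ)⁻¹ * (ENNReal.ofReal |L.det⁻¹| * T Set.univ) := mul_le_mul_right h _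
    _ = ENNReal.ofReal |L.det⁻¹| := by
        rw [mul_comm, mul_assoc, ENNReal.mul_inv_cancel hT0 hTt, mul_one]

end Polar

theorem isProbabilityMeasure_sphereUniform {d : ℕ} (hd : 1 ≤ d) :
    IsProbabilityMeasure (sphereUniform d) := by
  have : Nonempty (Fin d) := ⟨⟨0, hd⟩⟩
  have h0 : (volume : Measure (EuclideanSpace ℝ (Fin d))).toSphere Set.univ ≠ 0 :=
    (Measure.measure_univ_ne_zero).mpr (Measure.toSphere_ne_zero _)
  exact ⟨ENNReal.inv_mul_cancel h0 (measure_ne_top _ _)⟩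

/-- The Chernoff bound for the overlap of a uniform unit vector with the range of a projection:
`a` and `b` are free subject to `p a² + (1 - p) b² = 1`. -/
theorem sphereUniform_overlap_le {d : ℕ} (hd : 1 ≤ d) {P : Matrix (Fin d) (Fin d) ℝ}
    (hP : IsOrthProj P) {a b p D : ℝ} (ha : 0 ≤ a) (hab : a ≤ b)
    (hconstr : p * a ^ 2 + (1 - p) * b ^ 2 = 1) (hD : 0 < D)
    (hdet : D ≤ (a • P + b • (1 - P)).det) :
    sphereUniform d {u | p < u.1.ofLp ⬝ᵥ (P *ᵥ u.1.ofLp)} ≤ ENNReal.ofReal D⁻¹ := by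
  set L := a • P + b • (1 - P) with hL
  have hLpos : 0 < L.det := hD.trans_le hdet
  have hs : MeasurableSet {u : Metric.sphere (0 : EuclideanSpace ℝ (Fin d)) 1 |
      p < u.1.ofLp ⬝ᵥ (P *ᵥ u.1.ofLp)} := by
    have hc : Continuous fun u : Metric.sphere (0 : EuclideanSpace ℝ (Fin d)) 1 =>
        u.1.ofLp := (PiLp.continuous_ofLp 2 _).comp continuous_subtype_val
    have hc' : Continuous fun y : Fin d → ℝ => y ⬝ᵥ (P *ᵥ y) := by fun_prop
    exact measurableSet_lt measurable_const (hc'.comp hc).measurable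
  refine (sphereUniform_le_of_mulVec_le hd hLpos.ne' hs fun u hu => ?_).trans ?_
  · have hu1 := EuclideanSpace.sphere_dotProduct_self u
    have hu' : p < u.1.ofLp ⬝ᵥ (P *ᵥ u.1.ofLp) := hu
    generalize u.1.ofLp = y at hu1 hu'
    have hLt : Lᵀ = L := by
      rw [hL, transpose_add, transpose_smul, transpose_smul, hP.transpose_eq,
        hP.one_sub.transpose_eq]
    have hPQ : P * (1 - P) = 0 := by rw [mul_sub, hP.mul_self, Matrix.mul_one, sub_self]
    have hQP : (1 - P) * P = 0 := by rw [sub_mul, hP.mul_self, one_mul, sub_self]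
    have hLL : L * L = a ^ 2 • P + b ^ 2 • (1 - P) := by
      rw [hL]
      simp only [add_mul, mul_add, smul_mul, Matrix.mul_smul, hPQ, hQP, hP.mul_self,
        hP.one_sub.mul_self, smul_zero, add_zero, zero_add, smul_smul, sq]
    have e : (L *ᵥ y) ⬝ᵥ (L *ᵥ y) = b ^ 2 - (b ^ 2 - a ^ 2) * (y ⬝ᵥ (P *ᵥ y)) := by
      rw [dotProduct_mulVec, ← mulVec_transpose, hLt, mulVec_mulVec, hLL, dotProduct_comm]
      simp only [add_mulVec, smul_mulVec, sub_mulVec, one_mulVec, dotProduct_add, dotProduct_smul,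
        dotProduct_sub, hu1, smul_eq_mul]
      ring
    rw [e]
    have hab2 : 0 ≤ b ^ 2 - a ^ 2 := by nlinarith
    nlinarith
  · rw [abs_of_pos (inv_pos.mpr hLpos)]
    exact ENNReal.ofReal_le_ofReal (inv_anti₀ hD hdet)

namespace QueryAlgorithm

variable {d : ℕ} {S : Type*} [MeasurableSpace S]

theorem spanOverlap_le_one (A : QueryAlgorithm d S) (M : Matrix (Fin d) (Fin d) ℝ) (s : S) (t : ℕ)
    {u : Fin d → ℝ} (hu : u ⬝ᵥ u = 1) : A.spanOverlap M s t u ≤ 1 :=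
  hu ▸ (A.isOrthProj_spanProj M s t).dotProduct_mulVec_le u

/-- A uniform unit vector independent of the queries has overlap more than `τ / d` with the span of
`n` complex queries with probability about `exp (-τ / 2)`, as soon as `τ` is large compared with
the real dimension `2 n` of the span. -/
theorem sphereUniform_spanOverlap_le (hd : 1 ≤ d) (A : QueryAlgorithm d S)
    (M : Matrix (Fin d) (Fin d) ℝ) (s : S) (n : ℕ) {τ κ : ℝ} (hτ : 0 < τ) (hκ : 0 < κ) (hκ1 : κ < 1)
    (hn : 2 * n ≤ κ ^ 2 * τ) :
    sphereUniform d {u | τ / d < A.spanOverlap M s n u.1.ofLp} ≤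
      ENNReal.ofReal (Real.exp (-(τ * (1 / 2 - κ)))) := by
  have hd0 : (0 : ℝ) < d := by exact_mod_cast hd
  rcases le_or_gt (d : ℝ) τ with hτd | hτd
  -- For `τ ≥ d` the event is empty, as the overlap is at most one.
  · have hempty : {u : Metric.sphere (0 : EuclideanSpace ℝ (Fin d)) 1 |
        τ / d < A.spanOverlap M s n u.1.ofLp} = ∅ := by
      refine Set.eq_empty_of_forall_notMem fun u hu => ?_
      have h1 : τ / d < A.spanOverlap M s n u.1.ofLp := hu
      have h2 := A.spanOverlap_le_one M s n (EuclideanSpace.sphere_dotProduct_self u)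
      have h3 : 1 ≤ τ / d := (one_le_div hd0).mpr hτd
      linarith
    rw [hempty, measure_empty]
    exact zero_le
  set p := τ / d with hp
  have hp0 : 0 < p := div_pos hτ hd0
  have hp1 : p < 1 := (div_lt_one hd0).mpr hτd
  have hpd : d * p = τ := mul_div_cancel₀ _ hd0.ne'
  have hκ2 : κ ^ 2 < 1 := by nlinarith
  have hq1 : κ ^ 2 * p < 1 := by nlinarith
  -- The optimal tilt: the constraint of the Chernoff bound determines `b` from `a = κ`.
  set c := (1 - κ ^ 2 * p) / (1 - p) with hc
  have hc1 : 1 ≤ c := by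
    rw [hc, one_le_div (by linarith)]
    nlinarith
  have hc0 : 0 < c := by linarith
  have hb2 : √c ^ 2 = c := Real.sq_sqrt hc0.le
  have hb1 : 1 ≤ √c := Real.one_le_sqrt.mpr hc1
  have hb0 : 0 < √c := by linarith
  have hconstr : p * κ ^ 2 + (1 - p) * √c ^ 2 = 1 := by
    rw [hb2, hc, mul_div_cancel₀ _ (by linarith : (1 - p) ≠ 0)]
    ring
  have hD : 0 < √c ^ d * (κ / √c) ^ (2 * n) := by positivity
  refine (sphereUniform_overlap_le hd (A.isOrthProj_spanProj M s n) hκ.le (hκ1.le.trans hb1)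
    hconstr hD (A.le_det_spanProj M s hκ (hκ1.le.trans hb1) n)).trans ?_
  refine ENNReal.ofReal_le_ofReal ?_
  rw [Real.exp_neg]
  refine inv_anti₀ (Real.exp_pos _) ?_
  rw [← Real.le_log_iff_exp_le hD, Real.log_mul (by positivity) (by positivity), Real.log_pow,
    Real.log_pow, Real.log_div hκ.ne' hb0.ne', Real.log_sqrt hc0.le]
  have hlogc : 1 - c⁻¹ ≤ Real.log c := Real.one_sub_inv_le_log_of_pos hc0
  have hlogκ : 1 - κ⁻¹ ≤ Real.log κ := Real.one_sub_inv_le_log_of_pos hκ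
  have hneg : Real.log κ - Real.log c / 2 ≤ 0 := by
    have h1 := Real.log_nonpos hκ.le hκ1.le
    have h2 := Real.log_nonneg hc1
    linarith
  have hcinv : (d - κ ^ 2 * τ) * (1 - c⁻¹) = τ - κ ^ 2 * τ := by
    rw [hc, inv_div, ← hpd]
    have : 1 - κ ^ 2 * p ≠ 0 := by linarith
    field_simp
    ring
  have hdim : 0 ≤ d - κ ^ 2 * τ := by nlinarith
  have h1 := mul_le_mul_of_nonneg_left hlogc hdim
  have h2 : κ ^ 2 * τ * (1 - κ⁻¹) ≤ κ ^ 2 * τ * Real.log κ :=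
    mul_le_mul_of_nonneg_left hlogκ (by positivity)
  have h3 : κ ^ 2 * τ * (1 - κ⁻¹) = κ ^ 2 * τ - κ * τ := by field_simp
  have h4 := mul_le_mul_of_nonpos_right hn hneg
  have h5 : 0 ≤ κ ^ 2 * τ := by positivity
  push_cast
  nlinarith

end QueryAlgorithm

/-! ### The thresholds -/

theorem threshold_succ (lam δ : ℝ) (k : ℕ) :
    threshold lam δ (k + 1) = lam ^ 4 * threshold lam δ k := by
  unfold threshold
  ring

section Threshold

variable {lam δ : ℝ}

theorem one_le_log_inv (hδ : 0 < δ) (hδ' : δ < 1 / Real.exp 1) : 1 ≤ Real.log δ⁻¹ := by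
  rw [Real.le_log_iff_exp_le (inv_pos.mpr hδ), le_inv_comm₀ (Real.exp_pos _) hδ, ← one_div]
  exact hδ'.le

theorem threshold_pos (hlam : 1 < lam) (hδ : 0 < δ) (hδ' : δ < 1 / Real.exp 1) (k : ℕ) :
    0 < threshold lam δ k := by
  have h1 := one_le_log_inv hδ hδ'
  have h2 := Real.log_pos hlam
  have h3 : 0 < lam - 1 := by linarith
  unfold threshold
  positivity

/-- The growth of the thresholds: `exp x ≥ 1 + x` gives `lam ^ (4 k) ≥ 1 + 4 k log lam`,
where the summand `1 / log lam` of the threshold compensates the factor `log lam`. -/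
theorem log_inv_add_le (hlam : 1 < lam) (hδ : 0 < δ) (hδ' : δ < 1 / Real.exp 1) (k : ℕ) :
    Real.log δ⁻¹ + 4 * k ≤ lam ^ (4 * k) * (Real.log δ⁻¹ + (Real.log lam)⁻¹) := by
  have h1 := one_le_log_inv hδ hδ'
  have h2 := Real.log_pos hlam
  have h3 : 1 + 4 * k * Real.log lam ≤ lam ^ (4 * k) := by
    have := Real.add_one_le_exp (((4 * k : ℕ) : ℝ) * Real.log lam)
    rw [Real.exp_nat_mul, Real.exp_log (by linarith)] at this
    push_cast at this
    linarith
  have h4 : 0 < (Real.log lam)⁻¹ := inv_pos.mpr h2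
  calc Real.log δ⁻¹ + 4 * k = Real.log δ⁻¹ + 4 * k * (Real.log lam * (Real.log lam)⁻¹) := by
        rw [mul_inv_cancel₀ h2.ne', mul_one]
    _ ≤ (1 + 4 * k * Real.log lam) * (Real.log δ⁻¹ + (Real.log lam)⁻¹) := by
        have : 0 ≤ 4 * k * Real.log lam * Real.log δ⁻¹ := by positivity
        nlinarith
    _ ≤ _ := mul_le_mul_of_nonneg_right h3 (by positivity)

theorem mul_threshold (hlam : 1 < lam) (k : ℕ) : lam ^ 2 * (lam - 1) ^ 2 * threshold lam δ k =
    64 * (lam ^ (4 * k) * (Real.log δ⁻¹ + (Real.log lam)⁻¹)) := by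
  have h0 : lam ≠ 0 := by linarith
  have h1 : lam - 1 ≠ 0 := by linarith
  unfold threshold
  generalize Real.log δ⁻¹ + (Real.log lam)⁻¹ = X
  field_simp

/-- The threshold dominates the real dimension `2 (k + 1)` of the span of `k + 1` queries, by the
factor needed for the Chernoff bound with `κ = (lam - 1) / (4 lam)`. -/
theorem two_mul_succ_le_threshold (hlam : 1 < lam) (hδ : 0 < δ) (hδ' : δ < 1 / Real.exp 1) (k : ℕ) :
    2 * ((k + 1 : ℕ) : ℝ) ≤ ((lam - 1) / (4 * lam)) ^ 2 * threshold lam δ (k + 1) := by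
  have h0 : 0 < lam := by linarith
  have e : ((lam - 1) / (4 * lam)) ^ 2 * threshold lam δ (k + 1) =
      lam ^ 2 * (lam - 1) ^ 2 * threshold lam δ k / 16 := by
    rw [threshold_succ]
    field_simp
    ring
  rw [e, mul_threshold hlam]
  have h1 := log_inv_add_le hlam hδ hδ' k
  have h2 := one_le_log_inv hδ hδ'
  have h3 : (0 : ℝ) ≤ k := k.cast_nonneg
  push_cast
  linarith

/-- The bound for one round, in a form that sums to `δ`. -/
theorem exp_neg_threshold_le (hlam : 1 < lam) (hδ : 0 < δ) (hδ' : δ < 1 / Real.exp 1) (k : ℕ) :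
    Real.exp (-(lam ^ 2 * (lam - 1) ^ 2 * threshold lam δ k / 4)) ≤ δ * (1 / 2) ^ (k + 1) := by
  have h1 := log_inv_add_le hlam hδ hδ' k
  have h2 := one_le_log_inv hδ hδ'
  have h3 : (0 : ℝ) ≤ k := k.cast_nonneg
  have h4 : Real.exp (-1) ≤ 1 / 2 := by
    have := Real.add_one_le_exp 1
    rw [Real.exp_neg, one_div]
    exact inv_anti₀ (by norm_num) (by linarith)
  rw [mul_threshold hlam]
  calc _ ≤ Real.exp (-Real.log δ⁻¹ + ((k + 1 : ℕ) : ℝ) * (-1)) := by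
        refine Real.exp_le_exp.mpr ?_
        push_cast
        linarith
    _ = δ * Real.exp (-1) ^ (k + 1) := by
        rw [Real.exp_add, Real.exp_nat_mul, Real.log_inv, neg_neg, Real.exp_log hδ]
    _ ≤ _ := by gcongr

end Threshold

/-! ### The overlap of orthonormal queries -/

/-- Orthonormal columns in the range of a real projection `P` have overlap at most `‖P u‖²`, since
`P - V Vᴴ` is again an orthogonal projection. -/
theorem overlap_le_of_mul_eq {𝕜 : Type*} [RCLike 𝕜] {d : ℕ} {ι : Type*} [Fintype ι] [DecidableEq ι]
    {V : Matrix (Fin d) ι 𝕜} (hV : V ∈ Stief 𝕜 d ι) {P : Matrix (Fin d) (Fin d) ℝ}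
    (hP : IsOrthProj P) (hPV : P.map (algebraMap ℝ 𝕜) * V = V) (u : EuclideanSpace ℝ (Fin d)) :
    overlap V u ≤ u.ofLp ⬝ᵥ (P *ᵥ u.ofLp) := by
  have hV' : Vᴴ * V = 1 := hV
  set Q := P.map (algebraMap ℝ 𝕜) with hQ
  set w : Fin d → 𝕜 := fun i => algebraMap ℝ 𝕜 (u i) with hw
  have hQQ : Q * Q = Q := by rw [hQ, ← Matrix.map_mul, hP.mul_self]
  have hQh : Qᴴ = Q := by
    ext i j
    have hsymm : P j i = P i j := congrFun (congrFun hP.transpose_eq i) j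
    rw [hQ, conjTranspose_apply, map_apply, map_apply, hsymm]
    simp
  have hVQ : Vᴴ * Q = Vᴴ := by
    have := congrArg conjTranspose hPV
    rwa [conjTranspose_mul, hQh] at this
  set R := Q - V * Vᴴ with hR
  have hRh : Rᴴ = R := by
    rw [hR, conjTranspose_sub, conjTranspose_mul, conjTranspose_conjTranspose, hQh]
  have hRR : Rᴴ * R = R := by
    have h1 : Q * (V * Vᴴ) = V * Vᴴ := by rw [← Matrix.mul_assoc, hPV]
    have h2 : V * Vᴴ * Q = V * Vᴴ := by rw [Matrix.mul_assoc, hVQ]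
    have h3 : V * Vᴴ * (V * Vᴴ) = V * Vᴴ := by
      rw [Matrix.mul_assoc, ← Matrix.mul_assoc Vᴴ, hV', Matrix.one_mul]
    rw [hRh, hR, sub_mul, mul_sub, mul_sub, hQQ, h1, h2, h3, sub_self, sub_zero]
  have hnonneg : 0 ≤ RCLike.re (star w ⬝ᵥ (R *ᵥ w)) := by
    rw [← hRR, ← Matrix.mulVec_mulVec, dotProduct_mulVec, ← star_mulVec]
    simp only [dotProduct, map_sum, Pi.star_apply, RCLike.star_def, RCLike.conj_mul]
    exact Finset.sum_nonneg fun i _ => by norm_cast; positivity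
  have hQw : RCLike.re (star w ⬝ᵥ (Q *ᵥ w)) = u.ofLp ⬝ᵥ (P *ᵥ u.ofLp) := by
    have h1 : star w = algebraMap ℝ 𝕜 ∘ u.ofLp := by ext i; simp [hw]
    have h2 : Q *ᵥ w = algebraMap ℝ 𝕜 ∘ (P *ᵥ u.ofLp) := by
      ext i
      exact (RingHom.map_mulVec (algebraMap ℝ 𝕜) P u.ofLp i).symm
    rw [h1, h2, ← RingHom.map_dotProduct, RCLike.algebraMap_eq_ofReal, RCLike.ofReal_re]
  have hov : overlap V u = RCLike.re (star w ⬝ᵥ ((V * Vᴴ) *ᵥ w)) := rfl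
  have hsplit : RCLike.re (star w ⬝ᵥ (R *ᵥ w)) =
      RCLike.re (star w ⬝ᵥ (Q *ᵥ w)) - RCLike.re (star w ⬝ᵥ ((V * Vᴴ) *ᵥ w)) := by
    rw [hR, sub_mulVec, dotProduct_sub, map_sub]
  rw [hov]
  linarith

theorem submatrix_mem_stief {𝕜 : Type*} [RCLike 𝕜] {d : ℕ} {ι κ : Type*} [DecidableEq ι]
    [DecidableEq κ] {V : Matrix (Fin d) ι 𝕜} (hV : V ∈ Stief 𝕜 d ι) {e : κ → ι}
    (he : Function.Injective e) : V.submatrix id e ∈ Stief 𝕜 d κ := by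
  have hV' : Vᴴ * V = 1 := hV
  change (V.submatrix id e)ᴴ * V.submatrix id e = 1
  rw [conjTranspose_submatrix, ← submatrix_mul Vᴴ V e id e Function.bijective_id,
    hV', submatrix_one _ he]

namespace QueryAlgorithm

variable {d : ℕ} {S : Type*} [MeasurableSpace S] (A : QueryAlgorithm d S)
  (M : Matrix (Fin d) (Fin d) ℝ) (s : S) {N k : ℕ}

theorem overlap_realV_le (hk : k ≤ N) (h : A.realV M s N ∈ Stief ℝ d (Fin N × Fin 2))
    (u : EuclideanSpace ℝ (Fin d)) :
    overlap (A.realV M s k) u ≤ A.spanOverlap M s k u.ofLp := by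
  refine overlap_le_of_mul_eq ?_ (A.isOrthProj_spanProj M s k) ?_ u
  · exact submatrix_mem_stief h (e := Prod.map (Fin.castLE hk) id)
      ((Fin.castLE_injective hk).prodMap Function.injective_id)
  · ext i ⟨j, r⟩
    have hre := congrFun (A.spanProj_mulVec_queryRe M s j.2) i
    have him := congrFun (A.spanProj_mulVec_queryIm M s j.2) i
    fin_cases r
    · simpa [realV, mul_apply, mulVec, dotProduct, queryRe] using hre
    · simpa [realV, mul_apply, mulVec, dotProduct, queryIm] using him

theorem overlap_complexV_le (hk : k ≤ N) (h : A.complexV M s N ∈ Stief ℂ d (Fin N))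
    (u : EuclideanSpace ℝ (Fin d)) :
    overlap (A.complexV M s k) u ≤ A.spanOverlap M s k u.ofLp := by
  refine overlap_le_of_mul_eq ?_ (A.isOrthProj_spanProj M s k) ?_ u
  · exact submatrix_mem_stief h (e := Fin.castLE hk) (Fin.castLE_injective hk)
  · ext i j
    have hre := congrFun (A.spanProj_mulVec_queryRe M s j.2) i
    have him := congrFun (A.spanProj_mulVec_queryIm M s j.2) i
    apply Complex.ext
    · simpa [complexV, mul_apply, mulVec, dotProduct, queryRe] using hre
    · simpa [complexV, mul_apply, mulVec, dotProduct, queryIm] using him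

/-! ### The union bound -/

/-- For a fixed seed, the overlap crosses two consecutive thresholds in one round with small
probability. -/
theorem lintegral_measure_threshold_jump_le (hd : 1 ≤ d) {lam δ : ℝ} (hlam : 1 < lam) (hδ : 0 < δ)
    (hδ' : δ < 1 / Real.exp 1) (k : ℕ) :
    ∫⁻ u, ginOE d {G |
        A.spanOverlap (spikedMatrix lam (of G) u.1) s k u.1.ofLp ≤ threshold lam δ k / d ∧
        threshold lam δ (k + 1) / d <
          A.spanOverlap (spikedMatrix lam (of G) u.1) s (k + 1) u.1.ofLp}
        ∂sphereUniform d ≤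
      ENNReal.ofReal (δ * (1 / 2) ^ (k + 1)) := by
  have hd0 : (0 : ℝ) < d := by exact_mod_cast hd
  have hl0 : 0 < lam := by linarith
  have := isProbabilityMeasure_sphereUniform hd
  have hv : Measurable fun u : Metric.sphere (0 : EuclideanSpace ℝ (Fin d)) 1 => u.1.ofLp :=
    ((PiLp.continuous_ofLp 2 _).comp continuous_subtype_val).measurable
  set τ := threshold lam δ (k + 1) with hτ
  -- With this `κ` the rate `1 / 2 - κ` is `(lam + 1) / (4 lam)`; the power `1 - 1 / lam` of the
  -- tail then beats the moment by the exponent `lam² (lam - 1)² τ_k / 4`.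
  set κ := (lam - 1) / (4 * lam) with hκ
  have hκ0 : 0 < κ := div_pos (by linarith) (by linarith)
  have hκ1 : κ < 1 := by
    rw [hκ, div_lt_one (by linarith)]
    linarith
  have htail : ∀ M, sphereUniform d {u | τ / d < A.spanOverlap M s (k + 1) u.1.ofLp} ≤
      ENNReal.ofReal (Real.exp (-(τ * (1 / 2 - κ)))) := fun M =>
    A.sphereUniform_spanOverlap_le hd M s (k + 1) (threshold_pos hlam hδ hδ' _) hκ0 hκ1
      (two_mul_succ_le_threshold hlam hδ hδ' k)
  refine (A.lintegral_measure_jump_le hd s k hlam (threshold lam δ k / d) (τ / d) (sphereUniform d)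
    hv EuclideanSpace.sphere_dotProduct_self htail).trans ?_
  rw [ENNReal.ofReal_rpow_of_pos (Real.exp_pos _), ← ENNReal.ofReal_mul (by positivity),
    ← Real.exp_mul, ← Real.exp_add]
  refine ENNReal.ofReal_le_ofReal (le_trans (le_of_eq ?_) (exp_neg_threshold_le hlam hδ hδ' k))
  congr 1
  rw [hτ, hκ, threshold_succ]
  field_simp
  ring

/-- The overlap of the spike with the span of the queries stays below the thresholds, whether or
not the queries are orthonormal. -/
theorem measure_exists_threshold_lt_spanOverlap_le (hd : 1 ≤ d) {lam δ : ℝ} (hlam : 1 < lam)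
    (hδ : 0 < δ) (hδ' : δ < 1 / Real.exp 1) (ρ : Measure S) [IsProbabilityMeasure ρ] (N : ℕ) :
    ((ginOE d).prod ((sphereUniform d).prod ρ))
      {x | ∃ k ≤ N, threshold lam δ k / d <
        A.spanOverlap (spikedMatrix lam (of x.1) x.2.1) x.2.2 k x.2.1.1.ofLp} ≤
      ENNReal.ofReal δ := by
  have hd0 : (0 : ℝ) < d := by exact_mod_cast hd
  have := isProbabilityMeasure_sphereUniform hd
  set μ := (ginOE d).prod ((sphereUniform d).prod ρ) with hμ
  set Φ : ℕ → (Fin d → Fin d → ℝ) × Metric.sphere (0 : EuclideanSpace ℝ (Fin d)) 1 × S → ℝ :=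
    fun k x => A.spanOverlap (spikedMatrix lam (of x.1) x.2.1) x.2.2 k x.2.1.1.ofLp with hΦ
  have hΦm : ∀ k, Measurable (Φ k) := by
    intro k
    have h1 : Measurable fun x : (Fin d → Fin d → ℝ) ×
        Metric.sphere (0 : EuclideanSpace ℝ (Fin d)) 1 × S => x.2.1.1.ofLp :=
      ((PiLp.continuous_ofLp 2 _).comp continuous_subtype_val).measurable.comp
        (measurable_fst.comp measurable_snd)
    have h2 : Measurable fun z : Matrix (Fin d) (Fin d) ℝ × (Fin d → ℝ) =>
        z.1 + lam • vecMulVec z.2 z.2 :=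
      (by fun_prop : Continuous fun z : Matrix (Fin d) (Fin d) ℝ × (Fin d → ℝ) =>
        z.1 + lam • vecMulVec z.2 z.2).measurable
    have h3 : Measurable fun x : (Fin d → Fin d → ℝ) ×
        Metric.sphere (0 : EuclideanSpace ℝ (Fin d)) 1 × S => spikedMatrix lam (of x.1) x.2.1.1 :=
      h2.comp ((measurable_of.comp measurable_fst).prodMk h1)
    have h4 := (A.measurable_spanOverlap k).comp
      ((h3.prodMk (measurable_snd.comp measurable_snd)).prodMk h1)
    exact h4
  set B : ℕ → Set ((Fin d → Fin d → ℝ) × Metric.sphere (0 : EuclideanSpace ℝ (Fin d)) 1 × S) :=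
    fun k => {x | Φ k x ≤ threshold lam δ k / d ∧ threshold lam δ (k + 1) / d < Φ (k + 1) x} with hB
  have hBm : ∀ k, MeasurableSet (B k) := fun k =>
    (measurableSet_le (hΦm k) measurable_const).inter (measurableSet_lt measurable_const (hΦm _))
  have hBμ : ∀ k, μ (B k) ≤ ENNReal.ofReal (δ * (1 / 2) ^ (k + 1)) := by
    intro k
    rw [hμ, Measure.prod_apply_symm (hBm k),
      lintegral_prod_symm _ (measurable_measure_prodMk_right (hBm k)).aemeasurable]
    calc _ ≤ ∫⁻ _, ENNReal.ofReal (δ * (1 / 2) ^ (k + 1)) ∂ρ := lintegral_mono fun s =>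
          A.lintegral_measure_threshold_jump_le s hd hlam hδ hδ' k
      _ = _ := by simp
  -- The first index at which the threshold is exceeded is positive, as the overlap starts at zero.
  have hsub : {x | ∃ k ≤ N, threshold lam δ k / d < Φ k x} ⊆ ⋃ k ∈ Finset.range N, B k := by
    rintro x ⟨k, hk, hkx⟩
    induction k with
    | zero =>
      have h0 : Φ 0 x = 0 := by simp [hΦ, spanOverlap, spanProj]
      have := div_pos (threshold_pos hlam hδ hδ' 0) hd0
      linarith
    | succ k ih =>
      rcases lt_or_ge (threshold lam δ k / d) (Φ k x) with h | h
      · exact ih (by omega) h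
      · simp only [Set.mem_iUnion, Finset.mem_range]
        exact ⟨k, hk, h, hkx⟩
  have hsum : ∑ k ∈ Finset.range N, δ * (1 / 2 : ℝ) ^ (k + 1) ≤ δ := by
    rw [← Finset.mul_sum]
    have hgeom (n : ℕ) : ∑ k ∈ Finset.range n, (1 / 2 : ℝ) ^ (k + 1) = 1 - (1 / 2) ^ n := by
      induction n with
      | zero => simp
      | succ n ih => rw [Finset.sum_range_succ, ih]; ring
    rw [hgeom]
    have : 0 < (1 / 2 : ℝ) ^ N := by positivity
    nlinarith
  calc μ {x | ∃ k ≤ N, threshold lam δ k / d < Φ k x}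
      ≤ μ (⋃ k ∈ Finset.range N, B k) := measure_mono hsub
    _ ≤ ∑ k ∈ Finset.range N, μ (B k) := measure_biUnion_finset_le _ _
    _ ≤ ∑ k ∈ Finset.range N, ENNReal.ofReal (δ * (1 / 2) ^ (k + 1)) :=
        Finset.sum_le_sum fun k _ => hBμ k
    _ = ENNReal.ofReal (∑ k ∈ Finset.range N, δ * (1 / 2 : ℝ) ^ (k + 1)) :=
        (ENNReal.ofReal_sum_of_nonneg fun k _ => by positivity).symm
    _ ≤ ENNReal.ofReal δ := ENNReal.ofReal_le_ofReal hsum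

end QueryAlgorithm

end

theorem mainTheorem1 (d N : ℕ) (hd : 1 ≤ d) (lam δ : ℝ) (hlam : 1 < lam)
    (hδ : 0 < δ) (hδ' : δ < 1 / Real.exp 1)
    {S : Type*} [MeasurableSpace S] (ρ : Measure S) [IsProbabilityMeasure ρ]
    (A : QueryAlgorithm d S) :
    ((∀ M s, A.realV M s N ∈ Stief ℝ d (Fin N × Fin 2)) →
      ((ginOE d).prod ((sphereUniform d).prod ρ))
        {x | ∃ k ≤ N, threshold lam δ k / d <
          overlap (A.realV (spikedMatrix lam (Matrix.of x.1) x.2.1) x.2.2 k) x.2.1} ≤ ENNReal.ofReal δ) ∧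
    ((∀ M s, A.complexV M s N ∈ Stief ℂ d (Fin N)) →
      ((ginOE d).prod ((sphereUniform d).prod ρ))
        {x | ∃ k ≤ N, threshold lam δ k / d <
          overlap (A.complexV (spikedMatrix lam (Matrix.of x.1) x.2.1) x.2.2 k) x.2.1} ≤ ENNReal.ofReal δ) := by
  have hmain := A.measure_exists_threshold_lt_spanOverlap_le hd hlam hδ hδ' ρ N
  refine ⟨fun h => (measure_mono ?_).trans hmain, fun h => (measure_mono ?_).trans hmain⟩
  · rintro x ⟨k, hk, hx⟩
    exact ⟨k, hk, hx.trans_le (A.overlap_realV_le _ _ hk (h _ _) _)⟩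
  · rintro x ⟨k, hk, hx⟩
    exact ⟨k, hk, hx.trans_le (A.overlap_complexV_le _ _ hk (h _ _) _)⟩
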